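/- Let $I=[-1,1]$. For an integer $j\ge1$ let $\log^{(j)}$ and $E_j$ denote the $j$-fold iterated logarithm and the $j$-fold iterated exponential ($E_1(x)=e^x$, $E_{j+1}(x)=\exp(E_j(x))$). For an integer $k\ge1$ and a real $s>1$, a real-valued function $\psi\in C^\infty(I)$ belongs to the refined Gevrey class $G_k^s(I)$ if there is a constant $K>0$ such that, for all sufficiently large $n$, $$\sup_{t\in I}|\psi^{(n)}(t)|\le K^{n+1}\,n!\,Q_{k,s}(n)^n,\qquad Q_{k,s}(n)=(\log^{(k)}n)^s\prod_{j=1}^{k-1}\log^{(j)}n.$$ For $\psi \in C^1(I)$ real-valued and $\lambda\in\mathbb R$ put $$m(\lambda)=m_\psi(\lambda)=\mathrm{p.v.}\int_I e^{i\lambda\psi(t)}\,\frac{dt}{t}=\lim_{\varepsilon\to0^+}\int_{\varepsilon\le|t|\le1}e^{i\lambda\psi(t)}\,\frac{dt}{t}.$$ Theorem. Let $k\ge1$ be an integer and $s>1$. (a) If $\psi\in G_k^s(I)$ is real-valued, then the limit defining $m(\lambda)$ exists for every $\lambda\in\mathbb R$, and $m(\lambda)=O(\log^{(k+2)}\lambda)$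 as $\lambda\to\infty$, with an implicit constant that may depend on $\psi$, $k$ and $s$. (b) This bound is sharp: the function $\psi$ given by $\psi(t)=\exp\bigl(-E_k(t^{-1/(s-1)})\bigr)$ for $t>0$ and $\psi(t)=0$ for $t\le0$ belongs to $G_k^s(I)$, and there are a sequence $\lambda_n\to\infty$ and constants $c,C>0$ such that $c\log^{(k+2)}\lambda_n\le|m(\lambda_n)|\le C\log^{(k+2)}\lambda_n$ for all sufficiently large $n$. -/

import Mathlib

open Filter Asymptotics
open scoped Topology ContDiff

noncomputable section

namespace SteinWainger

/-- The interval `I = [-1, 1]`. -/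
def I : Set ℝ := Set.Icc (-1) 1

/-- The weight `Q_{k,s}(x) = (log^{(k)} x)^s * ∏_{j=1}^{k-1} log^{(j)} x`, where `log^{(j)}` is the
`j`-fold iterated logarithm; it is used for large `x` only, where all these logarithms are
positive. -/
def Q (k : ℕ) (s : ℝ) (x : ℝ) : ℝ :=
  (Real.log^[k] x) ^ s * ∏ j ∈ Finset.Ico 1 k, Real.log^[j] x

/-- `ψ` (restricted to `I`) belongs to the refined Gevrey class `G_k^s(I)`: it is smooth on `I`,
and for some `K > 0` and all sufficiently large `n`,
`sup_{t ∈ I} |ψ^{(n)}(t)| ≤ K^{n+1} n! Q_{k,s}(n)^n`. -/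
def RefinedGevrey (k : ℕ) (s : ℝ) (ψ : ℝ → ℝ) : Prop :=
  ContDiffOn ℝ ∞ ψ I ∧
    ∃ K : ℝ, 0 < K ∧ ∀ᶠ n : ℕ in atTop, ∀ t ∈ I,
      |iteratedDerivWithin n ψ I t| ≤ K ^ (n + 1) * (n.factorial : ℝ) * Q k s n ^ n

/-- The integral of `e^{iλψ(t)} / t` over `ε ≤ |t| ≤ 1`. -/
def truncated (ψ : ℝ → ℝ) (lam ε : ℝ) : ℂ :=
  (∫ t in (-1 : ℝ)..(-ε), Complex.exp (Complex.I * lam * ψ t) / t) +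
    ∫ t in ε..(1 : ℝ), Complex.exp (Complex.I * lam * ψ t) / t

/-- The oscillatory integral `m(λ) = p.v. ∫_I e^{iλψ(t)} dt/t`, the limit as `ε → 0+` of the
truncated integrals. -/
def m (ψ : ℝ → ℝ) (lam : ℝ) : ℂ :=
  limUnder (𝓝[>] (0 : ℝ)) (truncated ψ lam)

/-- The phase equal to `exp (-E_k(t^{-1/(s-1)}))` for `t > 0` and to `0` for `t ≤ 0`, with `E_k`
the `k`-fold iterated exponential. -/
def sharpPhase (k : ℕ) (s : ℝ) (t : ℝ) : ℝ :=
  if 0 < t then Real.exp (-(Real.exp^[k] (t ^ (-(1 / (s - 1)))))) else 0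

end SteinWainger

end

namespace SteinWainger

/-! ### Iterated logarithms and exponentials -/

/-! Upper bound. A constant has principal value zero, so `m` is the difference of the integrals
∫_0^1 (e^{iλφ(t)} - e^{iλφ(0)}) dt/t (`oneSided`) for φ = ψ and for its reflection. If some
derivative of ψ at 0 of order at least 1 is nonzero, let e + 1 be the first such order. Each
one-sided integral is then -(log λ)/(e + 1) e^{iλψ(0)} + O(1) (`oneSided_add_log_isBigO`). The
logarithms cancel, so `m` is bounded.

If ψ is flat at 0, the derivative bounds force it to be tiny there. Bang's argument (`bang`,
`exists_decay`) gives |ψ'| ≤ B e^{-n} on [0, c (log^{(k)}(n + 1))^{1-s}]; this length is comparable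
to the tail over i ≥ n of ∑ 1/(i Q(i)), which converges because s > 1. With n = ⌈log λ⌉ that
interval [0, α] contributes O(1), and [α, 1] contributes at most 2 log(1/α) = O(log^{(k+2)} λ).

Sharpness. The extremal phase extends holomorphically to the right half-plane. With X =
E_k(t^{-1/(s-1)}) it is at most e^{-X/2} on a disc about t of radius comparable to 1/Q(X)
(`disc_estimates`), so Cauchy's estimates and a maximisation over X (`Q_pow_mul_exp_le`) give
membership in the class. For the lower bound, -Re m(λ) is the integral of the nonnegative function
(1 - cos λψ)/t. Averaging over λ in [Λ, 2Λ] makes the cosine part on [α, 1] at most half of log(1/α)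
for some λ (`exists_integral_cos_div_le`). -/

lemma exp_iterate_le_exp_iterate {i j : ℕ} (h : i ≤ j) (c : ℝ) :
    Real.exp^[i] c ≤ Real.exp^[j] c := by
  refine monotone_nat_of_le_succ (f := fun n => Real.exp^[n] c) (fun n => ?_) h
  rw [Function.iterate_succ_apply']
  linarith [Real.add_one_le_exp (Real.exp^[n] c)]

lemma exp_iterate_mono (j : ℕ) : Monotone (Real.exp^[j]) :=
  Real.exp_monotone.iterate j

lemma one_le_exp_iterate (j : ℕ) {u : ℝ} (hu : 1 ≤ u) : 1 ≤ Real.exp^[j] u :=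
  hu.trans (exp_iterate_le_exp_iterate (Nat.zero_le j) u)

lemma one_le_exp_iterate_one (j : ℕ) : 1 ≤ Real.exp^[j] 1 := one_le_exp_iterate j le_rfl

lemma exp_iterate_le_log {j : ℕ} {c x : ℝ} (hx : 0 < x) (h : Real.exp^[j + 1] c ≤ x) :
    Real.exp^[j] c ≤ Real.log x := by
  rw [Function.iterate_succ_apply'] at h
  exact (Real.le_log_iff_exp_le hx).2 h

lemma pos_of_exp_iterate_one_le {j : ℕ} {x : ℝ} (h : Real.exp^[j] 1 ≤ x) : 0 < x :=
  zero_lt_one.trans_le ((one_le_exp_iterate_one j).trans h)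

lemma one_le_log_iterate {j : ℕ} {x : ℝ} (h : Real.exp^[j] 1 ≤ x) : 1 ≤ Real.log^[j] x := by
  induction j generalizing x with
  | zero => simpa using h
  | succ j ih => exact ih (exp_iterate_le_log (pos_of_exp_iterate_one_le h) h)

lemma log_iterate_le_log_iterate {j : ℕ} {x y : ℝ} (h : Real.exp^[j] 1 ≤ x) (hxy : x ≤ y) :
    Real.log^[j] x ≤ Real.log^[j] y := by
  induction j generalizing x y with
  | zero => simpa using hxy
  | succ j ih =>
    have hx := pos_of_exp_iterate_one_le h
    exact ih (exp_iterate_le_log hx h) (Real.log_le_log hx hxy)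

/-- One logarithm suffices: log(cx) ≤ (c - 1) + log x ≤ c log x as soon as log x ≥ 1. Iterate by
monotonicity. -/
lemma log_iterate_mul_le {j : ℕ} {x c : ℝ} (h : Real.exp^[j] 1 ≤ x) (hc : 1 ≤ c) :
    Real.log^[j] (c * x) ≤ c * Real.log^[j] x := by
  induction j generalizing x with
  | zero => simp
  | succ j ih =>
    have hx := pos_of_exp_iterate_one_le h
    have hl := exp_iterate_le_log hx h
    have h1 : 1 ≤ Real.log x := (one_le_exp_iterate_one j).trans hl
    have hlog : Real.log (c * x) ≤ c * Real.log x := by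
      rw [Real.log_mul (by positivity) hx.ne']
      nlinarith [Real.log_le_sub_one_of_pos (by positivity : 0 < c)]
    have hle : Real.log x ≤ Real.log (c * x) := Real.log_le_log hx (by nlinarith)
    exact (log_iterate_le_log_iterate (hl.trans hle) hlog).trans (ih hl)

lemma log_iterate_exp_iterate {i j : ℕ} (h : i ≤ j) (u : ℝ) :
    Real.log^[i] (Real.exp^[j] u) = Real.exp^[j - i] u := by
  obtain ⟨n, rfl⟩ := Nat.exists_eq_add_of_le h
  rw [Nat.add_sub_cancel_left, Function.iterate_add_apply]
  exact (Function.LeftInverse.iterate Real.log_exp i) _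

lemma tendsto_log_iterate (j : ℕ) : Tendsto (Real.log^[j]) atTop atTop :=
  Real.tendsto_log_atTop.iterate j

lemma exp_iterate_one_le_of_le {i j : ℕ} (h : i ≤ j) {x : ℝ} (hx : Real.exp^[j] 1 ≤ x) :
    Real.exp^[i] 1 ≤ x := (exp_iterate_le_exp_iterate h 1).trans hx

lemma hasDerivAt_log_iterate {j : ℕ} {x : ℝ} (h : Real.exp^[j] 1 ≤ x) :
    HasDerivAt (Real.log^[j]) (∏ i ∈ Finset.range j, Real.log^[i] x)⁻¹ x := by
  induction j with
  | zero => simpa using hasDerivAt_id x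
  | succ j ih =>
    have h' := exp_iterate_one_le_of_le j.le_succ h
    have := (ih h').log (by linarith [one_le_log_iterate h'])
    rw [Finset.prod_range_succ, mul_inv, ← div_eq_mul_inv]
    rw [Function.iterate_succ']
    exact this

/-! ### The weight `Q` -/

lemma one_le_Q {k : ℕ} {s x : ℝ} (hs : 0 ≤ s) (hx : Real.exp^[k] 1 ≤ x) : 1 ≤ Q k s x := by
  refine one_le_mul_of_one_le_of_one_le (Real.one_le_rpow (one_le_log_iterate hx) hs) ?_
  refine Finset.prod_induction _ (fun y : ℝ => 1 ≤ y)
    (fun a b ha hb => one_le_mul_of_one_le_of_one_le ha hb) le_rfl (fun j hj => ?_)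
  exact one_le_log_iterate (exp_iterate_one_le_of_le (Finset.mem_Ico.1 hj).2.le hx)

lemma Q_le_Q {k : ℕ} {s x y : ℝ} (hs : 0 ≤ s) (hx : Real.exp^[k] 1 ≤ x) (hxy : x ≤ y) :
    Q k s x ≤ Q k s y := by
  have h1 := one_le_log_iterate hx
  refine mul_le_mul (Real.rpow_le_rpow (by linarith) (log_iterate_le_log_iterate hx hxy) hs)
    (Finset.prod_le_prod (fun j hj => ?_) (fun j hj => ?_))
    (Finset.prod_nonneg (fun j hj => ?_)) (Real.rpow_nonneg ?_ _)
  · linarith [one_le_log_iterate (exp_iterate_one_le_of_le (Finset.mem_Ico.1 hj).2.le hx)]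
  · exact log_iterate_le_log_iterate (exp_iterate_one_le_of_le (Finset.mem_Ico.1 hj).2.le hx) hxy
  · linarith [one_le_log_iterate (exp_iterate_one_le_of_le (Finset.mem_Ico.1 hj).2.le hx)]
  · linarith [one_le_log_iterate (hx.trans hxy)]

/-- Each logarithm gains at most a factor c. The exponent is rounded up to a natural number so that
it can be used inside finite products. -/
lemma Q_mul_le {k : ℕ} {s x c : ℝ} (hs : 0 ≤ s) (hx : Real.exp^[k] 1 ≤ x) (hc : 1 ≤ c) :
    Q k s (c * x) ≤ c ^ (⌈s⌉₊ + k) * Q k s x := by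
  have hx0 := pos_of_exp_iterate_one_le hx
  have hcx : x ≤ c * x := by nlinarith
  have h1 := one_le_log_iterate hx
  have h2 : (Real.log^[k] (c * x)) ^ s ≤ c ^ ⌈s⌉₊ * (Real.log^[k] x) ^ s := by
    calc (Real.log^[k] (c * x)) ^ s ≤ (c * Real.log^[k] x) ^ s :=
          Real.rpow_le_rpow (by linarith [one_le_log_iterate (hx.trans hcx)])
            (log_iterate_mul_le hx hc) hs
      _ = c ^ s * (Real.log^[k] x) ^ s := Real.mul_rpow (by linarith) (by linarith)
      _ ≤ _ := by
          gcongr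
          rw [← Real.rpow_natCast]
          exact Real.rpow_le_rpow_of_exponent_le hc (Nat.le_ceil s)
  have h3 : ∏ j ∈ Finset.Ico 1 k, Real.log^[j] (c * x) ≤
      c ^ k * ∏ j ∈ Finset.Ico 1 k, Real.log^[j] x := by
    have hj : ∀ j ∈ Finset.Ico 1 k, Real.exp^[j] 1 ≤ x := fun j hj =>
      exp_iterate_one_le_of_le (Finset.mem_Ico.1 hj).2.le hx
    calc ∏ j ∈ Finset.Ico 1 k, Real.log^[j] (c * x)
        ≤ ∏ j ∈ Finset.Ico 1 k, c * Real.log^[j] x :=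
          Finset.prod_le_prod
            (fun j h => by linarith [one_le_log_iterate ((hj j h).trans hcx)])
            (fun j h => log_iterate_mul_le (hj j h) hc)
      _ = c ^ (k - 1) * ∏ j ∈ Finset.Ico 1 k, Real.log^[j] x := by
          rw [Finset.prod_mul_distrib]; simp
      _ ≤ _ := by
          gcongr
          · exact Finset.prod_nonneg fun j h => by linarith [one_le_log_iterate (hj j h)]
          · omega
  have h4 : 0 ≤ ∏ j ∈ Finset.Ico 1 k, Real.log^[j] (c * x) :=
    Finset.prod_nonneg fun j h => by
      linarith [one_le_log_iterate
        ((exp_iterate_one_le_of_le (Finset.mem_Ico.1 h).2.le hx).trans hcx)]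
  calc Q k s (c * x) ≤ (c ^ ⌈s⌉₊ * (Real.log^[k] x) ^ s) *
        (c ^ k * ∏ j ∈ Finset.Ico 1 k, Real.log^[j] x) :=
        mul_le_mul h2 h3 h4 (by positivity)
    _ = _ := by rw [Q, pow_add]; ring

lemma Q_exp_iterate {k : ℕ} (s u : ℝ) :
    Q k s (Real.exp^[k] u) = u ^ s * ∏ j ∈ Finset.Ico 1 k, Real.exp^[j] u := by
  have h : ∏ j ∈ Finset.Ico 1 k, Real.log^[j] (Real.exp^[k] u) =
      ∏ j ∈ Finset.Ico 1 k, Real.exp^[k - j] u :=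
    Finset.prod_congr rfl fun j hj => log_iterate_exp_iterate (Finset.mem_Ico.1 hj).2.le u
  rw [Q, h, log_iterate_exp_iterate le_rfl]
  congr 1
  · simp
  · refine Finset.prod_nbij' (fun j => k - j) (fun j => k - j) ?_ ?_ ?_ ?_
      (fun _ _ => rfl) <;> simp only [Finset.mem_Ico] <;> intros <;> omega

/-- `(log^{(k)} x)^{1-s}` is an antiderivative of `(1-s) / (x Q_{k,s}(x))`. -/
lemma hasDerivAt_log_iterate_rpow {k : ℕ} (hk : 1 ≤ k) {s x : ℝ} (hx : Real.exp^[k] 1 ≤ x) :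
    HasDerivAt (fun y => (Real.log^[k] y) ^ (1 - s)) ((1 - s) / (x * Q k s x)) x := by
  have h1 := one_le_log_iterate hx
  have := (hasDerivAt_log_iterate hx).rpow_const (p := 1 - s) (Or.inl (by linarith))
  convert this using 1
  have h2 : ∏ i ∈ Finset.range k, Real.log^[i] x = x * ∏ j ∈ Finset.Ico 1 k, Real.log^[j] x := by
    rw [Finset.range_eq_Ico, Finset.prod_eq_prod_Ico_succ_bot (by omega)]; simp
  rw [h2, Q, show 1 - s - 1 = -s by ring, Real.rpow_neg (by linarith)]
  simp only [div_eq_mul_inv, mul_inv]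
  ring

/-- Mean value theorem for the antiderivative above. Summed over integers the left side telescopes,
which bounds ∑ 1/(i Q(i)) from below. -/
lemma log_iterate_rpow_sub_le {k : ℕ} (hk : 1 ≤ k) {s x : ℝ} (hs : 1 < s)
    (hx : Real.exp^[k] 1 ≤ x) :
    (Real.log^[k] x) ^ (1 - s) - (Real.log^[k] (x + 1)) ^ (1 - s) ≤ (s - 1) / (x * Q k s x) := by
  have hx0 := pos_of_exp_iterate_one_le hx
  have hQ : ∀ y, x ≤ y → 1 ≤ Q k s y := fun y hy => one_le_Q (by linarith) (hx.trans hy)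
  obtain ⟨y, hy, hyeq⟩ := exists_hasDerivAt_eq_slope
    (fun y => (Real.log^[k] y) ^ (1 - s)) (fun y => (1 - s) / (y * Q k s y))
    (by linarith : x < x + 1)
    (fun y hy => (hasDerivAt_log_iterate_rpow hk (hx.trans hy.1)).continuousAt.continuousWithinAt)
    (fun y hy => hasDerivAt_log_iterate_rpow hk (hx.trans hy.1.le))
  have hle : x * Q k s x ≤ y * Q k s y :=
    mul_le_mul hy.1.le (Q_le_Q (by linarith) hx hy.1.le) (by linarith [hQ x le_rfl])
      (by linarith [hy.1])
  have hpos : 0 < x * Q k s x := mul_pos hx0 (by linarith [hQ x le_rfl])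
  have : (s - 1) / (y * Q k s y) ≤ (s - 1) / (x * Q k s x) :=
    div_le_div_of_nonneg_left (by linarith) hpos hle
  have h3 : (1 - s) / (y * Q k s y) = -((s - 1) / (y * Q k s y)) := by rw [← neg_div]; ring
  rw [h3, add_sub_cancel_left, div_one] at hyeq
  linarith

/-! ### Chains of derivatives on `[0, 1]` -/

/-- `f (n + 1)` is the derivative of `f n` on `[0, 1]`, for every `n`. -/
def IsDerivChain (f : ℕ → ℝ → ℝ) : Prop :=
  ∀ n, ∀ t ∈ Set.Icc (0 : ℝ) 1, HasDerivWithinAt (f n) (f (n + 1) t) (Set.Icc 0 1) t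

namespace IsDerivChain

variable {f : ℕ → ℝ → ℝ}

lemma continuousOn (hf : IsDerivChain f) (n : ℕ) : ContinuousOn (f n) (Set.Icc 0 1) :=
  fun t ht => (hf n t ht).continuousWithinAt

lemma hasDerivAt (hf : IsDerivChain f) (n : ℕ) {t : ℝ} (ht : t ∈ Set.Ioo (0 : ℝ) 1) :
    HasDerivAt (f n) (f (n + 1) t) t :=
  (hf n t ⟨ht.1.le, ht.2.le⟩).hasDerivAt (Icc_mem_nhds ht.1 ht.2)

lemma hasDerivWithinAt_Ici (hf : IsDerivChain f) (n : ℕ) {t : ℝ} (ht : t ∈ Set.Ico (0 : ℝ) 1) :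
    HasDerivWithinAt (f n) (f (n + 1) t) (Set.Ici t) t :=
  ((hf n t ⟨ht.1, ht.2.le⟩).mono (Set.Icc_subset_Icc_left ht.1)).mono_of_mem_nhdsWithin
    (Icc_mem_nhdsGE ht.2)

lemma exists_bound (hf : IsDerivChain f) (n : ℕ) :
    ∃ B, 0 < B ∧ ∀ t ∈ Set.Icc (0 : ℝ) 1, |f n t| ≤ B := by
  obtain ⟨B, hB⟩ := isCompact_Icc.exists_bound_of_continuousOn (hf.continuousOn n)
  exact ⟨max B 1, by positivity, fun t ht => (hB t ht).trans (le_max_left _ _)⟩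

/-- Taylor's formula in absolute values. The induction applies the bound of order n to the
derivative and integrates it by comparison of derivatives. -/
lemma abs_le_taylor (hf : IsDerivChain f) {x : ℝ} (hx : 0 ≤ x) {M : ℝ} (n : ℕ) :
    ∀ j, (∀ t ∈ Set.Icc (0 : ℝ) 1, |f (j + n) t| ≤ M) → ∀ y ∈ Set.Icc x 1,
      |f j y| ≤ ∑ i ∈ Finset.range n, |f (j + i) x| * (y - x) ^ i / i.factorial +
        M * (y - x) ^ n / n.factorial := by
  induction n with
  | zero =>
    intro j hM y hy
    simpa using hM y ⟨hx.trans hy.1, hy.2⟩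
  | succ n ih =>
    intro j hM y hy
    have ih' := ih (j + 1) (by simpa only [add_assoc, add_comm 1 n] using hM)
    have hpow : ∀ (i : ℕ) (c z : ℝ), HasDerivAt (fun z => c * (z - x) ^ (i + 1) / (i + 1).factorial)
        (c * (z - x) ^ i / i.factorial) z := by
      intro i c z
      refine (((((hasDerivAt_id z).sub_const x).pow (i + 1)).const_mul c).div_const
        ((i + 1).factorial : ℝ)).congr_deriv ?_
      have : (i.factorial : ℝ) ≠ 0 := by positivity
      rw [Nat.factorial_succ]
      push_cast
      simp only [id]
      field_simp
    have key := image_norm_le_of_norm_deriv_right_le_deriv_boundary (f := f j) (f' := f (j + 1))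
      (a := x) (b := 1)
      (B := fun z => |f j x| + ∑ i ∈ Finset.range n,
          |f (j + 1 + i) x| * (z - x) ^ (i + 1) / (i + 1).factorial +
        M * (z - x) ^ (n + 1) / (n + 1).factorial)
      (B' := fun z => ∑ i ∈ Finset.range n, |f (j + 1 + i) x| * (z - x) ^ i / i.factorial +
        M * (z - x) ^ n / n.factorial)
      ((hf.continuousOn j).mono (Set.Icc_subset_Icc_left hx))
      (fun z hz => hf.hasDerivWithinAt_Ici j ⟨hx.trans hz.1, hz.2⟩)
      (by simp)
      (fun z => ((HasDerivAt.fun_sum fun i _ => hpow i _ z).const_add _).add (hpow n M z))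
      (fun z hz => ih' z ⟨hz.1, hz.2.le⟩) hy
    rw [Finset.sum_range_succ', add_comm (Finset.sum _ _)]
    simpa [add_assoc, add_comm 1] using key

/-! ### Bang's estimate for flat functions -/

/-- Propagation of smallness: if the derivatives of order `j ≤ N + 1` at `x` are at most
`e^{j - (N + 1)} M_j`, then those of order `j ≤ N` at nearby points are at most `e^{j - N} M_j`. -/
lemma bang_step (hf : IsDerivChain f) {r M : ℕ → ℝ} (hr : Monotone r) (hr0 : ∀ i, 0 < r i)
    (hM0 : ∀ n, 0 < M n) (hM : ∀ n, M (n + 1) = M n * r n)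
    (hfM : ∀ n, ∀ t ∈ Set.Icc (0 : ℝ) 1, |f n t| ≤ M n) {N : ℕ} {x y : ℝ} (hx : 0 ≤ x)
    (hxy : x ≤ y) (hy : y ≤ 1) (hyx : y - x ≤ (Real.exp 1 * r N)⁻¹)
    (h : ∀ j, 1 ≤ j → j ≤ N + 1 → |f j x| ≤ Real.exp ((j : ℝ) - (N + 1 : ℕ)) * M j) :
    ∀ j, 1 ≤ j → j ≤ N → |f j y| ≤ Real.exp ((j : ℝ) - N) * M j := by
  intro j hj1 hjN
  obtain ⟨n, hn⟩ := Nat.exists_eq_add_of_le (hjN.trans N.le_succ)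
  have hMpow : ∀ i, j + i ≤ N + 1 → M (j + i) ≤ M j * r N ^ i := by
    intro i
    induction i with
    | zero => simp
    | succ i ih =>
      intro hi
      rw [← add_assoc, hM, pow_succ, ← mul_assoc]
      exact mul_le_mul (ih (by omega)) (hr (by omega)) (hr0 _).le
        (mul_nonneg (hM0 _).le (pow_nonneg (hr0 _).le _))
  have hd : 0 ≤ y - x := sub_nonneg.2 hxy
  -- Each Taylor term is a fixed factor times a term of the series of exp(e r_N (y - x)), whose
  -- argument is at most 1. The loss is thus at most one factor e. The remainder fits the same
  -- pattern, since at order N + 1 the exponential weight is 1.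
  have hterm : ∀ i, j + i ≤ N + 1 →
      Real.exp (((j + i : ℕ) : ℝ) - (N + 1 : ℕ)) * M (j + i) * (y - x) ^ i / i.factorial ≤
      Real.exp ((j : ℝ) - (N + 1 : ℕ)) * M j *
        ((Real.exp 1 * r N * (y - x)) ^ i / i.factorial) := by
    intro i hi
    have : Real.exp (((j + i : ℕ) : ℝ) - (N + 1 : ℕ)) =
        Real.exp ((j : ℝ) - (N + 1 : ℕ)) * Real.exp 1 ^ i := by
      rw [← Real.exp_nat_mul, ← Real.exp_add]
      push_cast; ring_nf
    rw [this, mul_pow, mul_pow]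
    calc _ ≤ Real.exp ((j : ℝ) - (N + 1 : ℕ)) * Real.exp 1 ^ i * (M j * r N ^ i) *
          (y - x) ^ i / i.factorial := by
            gcongr
            exact hMpow i hi
      _ = _ := by ring
  have hT := hf.abs_le_taylor hx n j (M := M (N + 1)) (by rw [← hn]; exact hfM _) y ⟨hxy, hy⟩
  have hsum : |f j y| ≤ ∑ i ∈ Finset.range (n + 1), Real.exp ((j : ℝ) - (N + 1 : ℕ)) * M j *
        ((Real.exp 1 * r N * (y - x)) ^ i / i.factorial) := by
    refine hT.trans ?_
    rw [Finset.sum_range_succ]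
    refine add_le_add (Finset.sum_le_sum fun i hi => ?_) ?_
    · have hi' : j + i ≤ N + 1 := by have := Finset.mem_range.1 hi; omega
      refine le_trans ?_ (hterm i hi')
      gcongr
      exact h _ (by omega) hi'
    · have := hterm n hn.ge
      rw [← hn, sub_self, Real.exp_zero, one_mul] at this
      exact this
  rw [← Finset.mul_sum] at hsum
  have hle1 : Real.exp 1 * r N * (y - x) ≤ 1 := by
    have hpos : 0 < Real.exp 1 * r N := mul_pos (Real.exp_pos _) (hr0 N)
    calc _ ≤ Real.exp 1 * r N * (Real.exp 1 * r N)⁻¹ := by gcongr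
      _ = 1 := mul_inv_cancel₀ hpos.ne'
  have hexp := Real.sum_le_exp_of_nonneg
    (mul_nonneg (mul_nonneg (Real.exp_pos 1).le (hr0 N).le) hd) (n + 1)
  refine hsum.trans ?_
  calc _ ≤ Real.exp ((j : ℝ) - (N + 1 : ℕ)) * M j * Real.exp 1 := by
        have := (hM0 j).le
        gcongr
        exact hexp.trans (Real.exp_le_exp.2 hle1)
    _ = Real.exp ((j : ℝ) - N) * M j := by
        rw [mul_right_comm, ← Real.exp_add]; push_cast; ring_nf

/-- Start at 0, where all derivatives vanish, with the order n + p, and walk right. Each step of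
length at most 1/(e r_i) costs one order in `bang_step`. -/
lemma bang (hf : IsDerivChain f) {r M : ℕ → ℝ} (hr : Monotone r) (hr0 : ∀ i, 0 < r i)
    (hM0 : ∀ n, 0 < M n) (hM : ∀ n, M (n + 1) = M n * r n)
    (hfM : ∀ n, ∀ t ∈ Set.Icc (0 : ℝ) 1, |f n t| ≤ M n) (hflat : ∀ j, 1 ≤ j → f j 0 = 0)
    (p n : ℕ) :
    ∀ x ∈ Set.Icc (0 : ℝ) 1, x ≤ ∑ i ∈ Finset.Ico n (n + p), (Real.exp 1 * r i)⁻¹ →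
      ∀ j, 1 ≤ j → j ≤ n → |f j x| ≤ Real.exp ((j : ℝ) - n) * M j := by
  induction p generalizing n with
  | zero =>
    intro x hx hxs j hj hjn
    have : x = 0 := le_antisymm (by simpa using hxs) hx.1
    rw [this, hflat j hj, abs_zero]
    exact mul_nonneg (Real.exp_pos _).le (hM0 j).le
  | succ p ih =>
    intro x hx hxs
    set σ := ∑ i ∈ Finset.Ico (n + 1) (n + 1 + p), (Real.exp 1 * r i)⁻¹ with hσ
    have hσ0 : 0 ≤ σ := Finset.sum_nonneg fun i _ =>
      inv_nonneg.2 (mul_nonneg (Real.exp_pos _).le (hr0 i).le)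
    rw [Finset.sum_eq_sum_Ico_succ_bot (by omega), show n + (p + 1) = n + 1 + p by ring,
      ← hσ] at hxs
    have hpos : 0 ≤ (Real.exp 1 * r n)⁻¹ :=
      inv_nonneg.2 (mul_nonneg (Real.exp_pos _).le (hr0 n).le)
    refine hf.bang_step hr hr0 hM0 hM hfM (x := min x σ) (le_min hx.1 hσ0) (min_le_left _ _) hx.2 ?_
      (ih (n + 1) _ ⟨le_min hx.1 hσ0, (min_le_left _ _).trans hx.2⟩ (min_le_right _ _))
    rcases min_cases x σ with h | h <;> linarith

/-- Flat functions with the derivative bounds of the class `G_k^s` are very small near `0`. -/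
lemma exists_decay (hf : IsDerivChain f) (hflat : ∀ j, 1 ≤ j → f j 0 = 0) {k : ℕ} (hk : 1 ≤ k)
    {s : ℝ} (hs : 1 < s) {K : ℝ} (hK : 0 < K)
    (hfK : ∀ᶠ n : ℕ in atTop, ∀ t ∈ Set.Icc (0 : ℝ) 1,
      |f n t| ≤ K ^ (n + 1) * (n.factorial : ℝ) * Q k s n ^ n) :
    ∃ c > 0, ∃ B > 0, ∀ᶠ n : ℕ in atTop, ∀ t ∈ Set.Icc (0 : ℝ) 1,
      t ≤ c * (Real.log^[k] ((n : ℝ) + 1)) ^ (1 - s) → |f 1 t| ≤ B * Real.exp (-n) := by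
  have hs0 : 0 ≤ s := by linarith
  obtain ⟨n₁, hn₁⟩ := eventually_atTop.1 hfK
  obtain ⟨n₂, hn₂⟩ := exists_nat_ge (Real.exp^[k] 1)
  set n₀ := max (max n₁ n₂) 1 with hn₀
  have hX : ∀ n : ℕ, n₀ ≤ n → Real.exp^[k] 1 ≤ n := fun n hn =>
    hn₂.trans (by exact_mod_cast (le_max_right n₁ n₂).trans ((le_max_left _ 1).trans hn))
  -- Freezing the weight below n₀ keeps every iterated logarithm at least 1 and makes the weight
  -- monotone on all of ℕ.
  set q : ℕ → ℝ := fun j => Q k s (max j n₀ : ℕ) with hq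
  have hq1 : ∀ j, 1 ≤ q j := fun j => one_le_Q hs0 (hX _ (le_max_right _ _))
  have hqmono : Monotone q := fun i j hij =>
    Q_le_Q hs0 (hX _ (le_max_right _ _)) (by exact_mod_cast max_le_max_right n₀ hij)
  set A := ⌈s⌉₊ + k with hA
  set C := K * Real.exp 1 ^ A with hC
  have hC0 : 0 < C := by positivity
  set r : ℕ → ℝ := fun i => C * (((i + 1 : ℕ) : ℝ) * q (i + 1)) with hr
  have hr0 : ∀ i, 0 < r i := fun i => by
    have := hq1 (i + 1)
    positivity
  have hrmono : Monotone r := fun i j hij => by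
    have := hq1 (i + 1)
    have h2 := hqmono (Nat.add_le_add_right hij 1)
    simp only [hr]
    gcongr
  have hprod : ∀ n, ∏ i ∈ Finset.range n, r i =
      C ^ n * n.factorial * ∏ i ∈ Finset.range n, q (i + 1) := by
    intro n
    simp only [hr, Finset.prod_mul_distrib, Finset.prod_const, Finset.card_range]
    rw [← Nat.cast_prod, Finset.prod_range_add_one_eq_factorial]
    ring
  have hprod0 : ∀ n, 0 < ∏ i ∈ Finset.range n, r i := fun n => Finset.prod_pos fun i _ => hr0 i
  have hlarge : ∀ n, n₀ ≤ n → ∀ t ∈ Set.Icc (0 : ℝ) 1,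
      |f n t| ≤ K * ∏ i ∈ Finset.range n, r i := by
    intro n hn t ht
    have hn1 : 1 ≤ n := (le_max_right _ _).trans hn
    refine (hn₁ n (((le_max_left _ _).trans (le_max_left _ _)).trans hn) t ht).trans ?_
    have hstep : ∀ i ∈ Finset.range n, Q k s n ≤ ((n : ℝ) / (i + 1 : ℕ)) ^ A * q (i + 1) := by
      intro i hi
      have hin : i + 1 ≤ n := Finset.mem_range.1 hi
      set l := max (i + 1) n₀ with hl
      have hln : l ≤ n := max_le hin hn
      have hil : i + 1 ≤ l := le_max_left _ _
      have hl0 : (0 : ℝ) < l := by exact_mod_cast (Nat.succ_pos i).trans_le hil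
      have h1 : Q k s n ≤ ((n : ℝ) / l) ^ A * Q k s l := by
        have := Q_mul_le hs0 (hX l (le_max_right _ _))
          ((one_le_div hl0).2 (by exact_mod_cast hln) : 1 ≤ (n : ℝ) / l)
        rwa [div_mul_cancel₀ _ hl0.ne'] at this
      refine h1.trans ?_
      have := hq1 (i + 1)
      have h3 : Q k s l = q (i + 1) := rfl
      rw [h3]
      gcongr
    -- Bang's argument needs bounds with monotone successive ratios, so Q(n)^n is replaced by ∏ q(i
    -- + 1). The cost is (∏ n/(i + 1))^A = (n^n/n!)^A ≤ e^{An}.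
    have hQn : Q k s n ^ n ≤ (Real.exp 1 ^ A) ^ n * ∏ i ∈ Finset.range n, q (i + 1) := by
      calc Q k s n ^ n = ∏ i ∈ Finset.range n, Q k s n := by simp
        _ ≤ ∏ i ∈ Finset.range n, (((n : ℝ) / (i + 1 : ℕ)) ^ A * q (i + 1)) :=
            Finset.prod_le_prod (fun i _ => by linarith [one_le_Q hs0 (hX n hn)]) hstep
        _ = ((n : ℝ) ^ n / n.factorial) ^ A * ∏ i ∈ Finset.range n, q (i + 1) := by
            rw [Finset.prod_mul_distrib, Finset.prod_pow, Finset.prod_div_distrib,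
              ← Nat.cast_prod (fun i => i + 1), Finset.prod_range_add_one_eq_factorial]
            simp
        _ ≤ _ := by
            rw [← pow_mul, mul_comm A n, pow_mul, ← Real.exp_nat_mul 1 n, mul_one]
            have : 0 ≤ ∏ i ∈ Finset.range n, q (i + 1) :=
              Finset.prod_nonneg fun i _ => by linarith [hq1 (i + 1)]
            gcongr
            exact Real.pow_div_factorial_le_exp _ (Nat.cast_nonneg n) n
    rw [hprod, hC, mul_pow]
    calc _ ≤ K ^ (n + 1) * n.factorial *
          ((Real.exp 1 ^ A) ^ n * ∏ i ∈ Finset.range n, q (i + 1)) := by gcongr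
      _ = _ := by ring
  choose b hb0 hb using hf.exists_bound
  -- The sum absorbs the finitely many orders below n₀, where only compactness bounds the
  -- derivatives.
  set C' := K + ∑ n ∈ Finset.range n₀, b n / ∏ i ∈ Finset.range n, r i with hC'
  have hterm : ∀ n, 0 ≤ b n / ∏ i ∈ Finset.range n, r i := fun n =>
    div_nonneg (hb0 n).le (hprod0 n).le
  have hKC' : K ≤ C' := le_add_of_nonneg_right (Finset.sum_nonneg fun n _ => hterm n)
  have hC'0 : 0 < C' := hK.trans_le hKC'
  set M : ℕ → ℝ := fun n => C' * ∏ i ∈ Finset.range n, r i with hMdef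
  have hM0 : ∀ n, 0 < M n := fun n => mul_pos hC'0 (hprod0 n)
  have hM : ∀ n, M (n + 1) = M n * r n := fun n => by
    simp only [hMdef, Finset.prod_range_succ, mul_assoc]
  have hfM : ∀ n, ∀ t ∈ Set.Icc (0 : ℝ) 1, |f n t| ≤ M n := by
    intro n t ht
    rcases le_or_gt n₀ n with hn | hn
    · exact (hlarge n hn t ht).trans (mul_le_mul_of_nonneg_right hKC' (hprod0 n).le)
    · refine (hb n t ht).trans ((div_le_iff₀ (hprod0 n)).1 ?_)
      refine le_trans ?_ (le_add_of_nonneg_left hK.le)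
      exact Finset.single_le_sum (f := fun n => b n / ∏ i ∈ Finset.range n, r i)
        (fun n _ => hterm n) (Finset.mem_range.2 hn)
  -- The factor 2 leaves room to stop the sum at a finite p with G(n + p + 1) ≤ G(n + 1)/2.
  set c := (2 * (Real.exp 1 * C * (s - 1)))⁻¹ with hc
  have hs1 : 0 < s - 1 := by linarith
  have hc0 : 0 < c := by positivity
  set G : ℕ → ℝ := fun n => (Real.log^[k] (n : ℝ)) ^ (1 - s) with hG
  have hGlim : Tendsto G atTop (𝓝 0) := by
    have := (tendsto_rpow_neg_atTop hs1).comp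
      ((tendsto_log_iterate k).comp tendsto_natCast_atTop_atTop)
    simpa [hG, Function.comp_def, neg_sub] using this
  have hsum : ∀ n, n₀ ≤ n → ∀ p, 2 * c * (G (n + 1) - G (n + p + 1)) ≤
      ∑ i ∈ Finset.Ico n (n + p), (Real.exp 1 * r i)⁻¹ := by
    intro n hn p
    induction p with
    | zero => simp
    | succ p ih =>
      rw [← add_assoc, Finset.sum_Ico_succ_top (by omega)]
      have hle : n₀ ≤ n + p + 1 := by omega
      have h1 := log_iterate_rpow_sub_le hk hs (hX (n + p + 1) hle)
      have h2 : (Real.exp 1 * r (n + p))⁻¹ =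
          2 * c * ((s - 1) / (((n + p + 1 : ℕ) : ℝ) * Q k s (n + p + 1 : ℕ))) := by
        have hQ := one_le_Q hs0 (hX (n + p + 1) hle)
        simp only [hr, hq, hc, max_eq_left hle]
        field_simp
      have h3 : G (n + p + 1) - G (n + p + 1 + 1) ≤
          (s - 1) / (((n + p + 1 : ℕ) : ℝ) * Q k s (n + p + 1 : ℕ)) := by
        simpa [hG] using h1
      have h4 := mul_le_mul_of_nonneg_left h3 (by positivity : 0 ≤ 2 * c)
      linarith
  refine ⟨c, hc0, Real.exp 1 * M 1, mul_pos (Real.exp_pos _) (hM0 1), ?_⟩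
  filter_upwards [eventually_ge_atTop n₀] with n hn t ht htc
  have hn1 : 1 ≤ n := (le_max_right _ _).trans hn
  have hGpos : 0 < G (n + 1) := Real.rpow_pos_of_pos
    (by linarith [one_le_log_iterate (hX (n + 1) (by omega))]) _
  obtain ⟨p, hp⟩ : ∃ p : ℕ, G (n + p + 1) ≤ G (n + 1) / 2 := by
    obtain ⟨p, hp⟩ := eventually_atTop.1 (hGlim.eventually (ge_mem_nhds (half_pos hGpos)))
    exact ⟨p, hp _ (by omega)⟩
  have htG : t ≤ c * G (n + 1) := by simpa [hG] using htc
  have := hf.bang hrmono hr0 hM0 hM hfM hflat p n t ht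
    (htG.trans (le_trans (by nlinarith) (hsum n hn p))) 1 le_rfl hn1
  refine this.trans (le_of_eq ?_)
  rw [mul_right_comm, ← Real.exp_add, Nat.cast_one, sub_eq_add_neg]

end IsDerivChain

/-! ### One-sided oscillatory integrals -/

lemma norm_cexp_phase (lam x : ℝ) : ‖Complex.exp (Complex.I * lam * x)‖ = 1 := by
  rw [show Complex.I * (lam : ℂ) * x = ((lam * x : ℝ) : ℂ) * Complex.I by push_cast; ring]
  exact Complex.norm_exp_ofReal_mul_I _

lemma norm_cexp_phase_sub_le (lam x y : ℝ) :
    ‖Complex.exp (Complex.I * lam * x) - Complex.exp (Complex.I * lam * y)‖ ≤ |lam| * |x - y| := by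
  have h : Complex.exp (Complex.I * lam * x) - Complex.exp (Complex.I * lam * y) =
      Complex.exp (Complex.I * lam * y) * (Complex.exp (Complex.I * (lam * (x - y) : ℝ)) - 1) := by
    rw [mul_sub, ← Complex.exp_add, mul_one]
    push_cast
    ring_nf
  rw [h, norm_mul, norm_cexp_phase, one_mul, ← abs_mul]
  exact Real.norm_exp_I_mul_ofReal_sub_one_le

lemma continuousOn_cexp_phase {φ : ℝ → ℝ} {S : Set ℝ} (hφ : ContinuousOn φ S) (lam : ℝ) :
    ContinuousOn (fun t => Complex.exp (Complex.I * lam * φ t)) S := by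
  fun_prop

/-- The integral `∫_0^1 (e^{iλφ(t)} - e^{iλφ(0)}) dt/t`. -/
noncomputable def oneSided (φ : ℝ → ℝ) (lam : ℝ) : ℂ :=
  ∫ t in (0 : ℝ)..1, (Complex.exp (Complex.I * lam * φ t) - Complex.exp (Complex.I * lam * φ 0)) / t

lemma intervalIntegrable_of_continuousOn_Ioc_of_bound {g : ℝ → ℂ} {B : ℝ}
    (hg : ContinuousOn g (Set.Ioc 0 1)) (hB : ∀ t ∈ Set.Ioc (0 : ℝ) 1, ‖g t‖ ≤ B) :
    IntervalIntegrable g MeasureTheory.volume 0 1 := by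
  rw [intervalIntegrable_iff_integrableOn_Ioc_of_le zero_le_one]
  exact MeasureTheory.IntegrableOn.of_bound (C := B) (by simp)
    (hg.aestronglyMeasurable measurableSet_Ioc)
    ((MeasureTheory.ae_restrict_iff' measurableSet_Ioc).2 (Eventually.of_forall hB))

lemma intervalIntegrable_div_id {F : ℝ → ℂ} (hF : ContinuousOn F (Set.Icc 0 1)) {a b : ℝ}
    (ha : 0 < a) (hab : a ≤ b) (hb : b ≤ 1) :
    IntervalIntegrable (fun t => F t / t) MeasureTheory.volume a b := by
  apply ContinuousOn.intervalIntegrable_of_Icc hab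
  refine (hF.mono (Set.Icc_subset_Icc ha.le hb)).div Complex.continuous_ofReal.continuousOn ?_
  intro t ht
  exact_mod_cast (ha.trans_le ht.1).ne'

lemma integral_const_div_id (c : ℂ) {a : ℝ} (ha : 0 < a) :
    ∫ t in a..(1 : ℝ), c / t = -(Real.log a * c) := by
  have : ∀ t : ℝ, c / (t : ℂ) = c * ((t⁻¹ : ℝ) : ℂ) := fun t => by push_cast; rw [div_eq_mul_inv]
  simp only [this]
  rw [intervalIntegral.integral_const_mul, intervalIntegral.integral_ofReal,
    integral_inv_of_pos ha one_pos, one_div, Real.log_inv]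
  push_cast
  ring

lemma norm_integral_div_id_le {F : ℝ → ℂ} {B a : ℝ} (ha : 0 < a) (ha1 : a ≤ 1)
    (hB : ∀ t ∈ Set.Icc a 1, ‖F t‖ ≤ B) :
    ‖∫ t in a..(1 : ℝ), F t / t‖ ≤ B * -Real.log a := by
  have h0 : (0 : ℝ) ∉ Set.uIcc a 1 := by
    rw [Set.uIcc_of_le ha1]; exact fun h => absurd h.1 (not_le.2 ha)
  refine (intervalIntegral.norm_integral_le_of_norm_le (g := fun t => B * t⁻¹) ha1
    (Eventually.of_forall fun t ht => ?_) ?_).trans (le_of_eq ?_)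
  · have ht0 : 0 < t := ha.trans ht.1
    rw [norm_div, Complex.norm_real, Real.norm_of_nonneg ht0.le, div_eq_mul_inv]
    exact mul_le_mul_of_nonneg_right (hB t ⟨ht.1.le, ht.2⟩) (inv_nonneg.2 ht0.le)
  · exact (intervalIntegrable_inv_iff.2 (Or.inr h0)).const_mul B
  · rw [intervalIntegral.integral_const_mul, integral_inv_of_pos ha one_pos, one_div, Real.log_inv]

lemma abs_le_of_abs_deriv_le_pow {g g' : ℝ → ℝ}
    (hg : ∀ t ∈ Set.Icc (0 : ℝ) 1, HasDerivWithinAt g (g' t) (Set.Icc 0 1) t) (hg0 : g 0 = 0)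
    {C : ℝ} (hC : 0 ≤ C) {n : ℕ} (hg' : ∀ t ∈ Set.Icc (0 : ℝ) 1, |g' t| ≤ C * t ^ n) :
    ∀ t ∈ Set.Icc (0 : ℝ) 1, |g t| ≤ C * t ^ (n + 1) := by
  intro t ht
  refine image_norm_le_of_norm_deriv_right_le_deriv_boundary (f := g) (f' := g') (a := 0) (b := 1)
    (B := fun z => C * z ^ (n + 1)) (B' := fun z => C * ((n + 1 : ℕ) * z ^ n))
    (fun t ht => (hg t ht).continuousWithinAt)
    (fun z hz => ((hg z ⟨hz.1, hz.2.le⟩).mono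
      (Set.Icc_subset_Icc_left hz.1)).mono_of_mem_nhdsWithin (Icc_mem_nhdsGE hz.2))
    (by simp [hg0]) (fun z => (hasDerivAt_pow (n + 1) z).const_mul C) (fun z hz => ?_) ht
  refine (hg' z ⟨hz.1, hz.2.le⟩).trans (mul_le_mul_of_nonneg_left ?_ hC)
  have := pow_nonneg hz.1 n
  push_cast
  nlinarith [(Nat.cast_nonneg n : (0 : ℝ) ≤ n)]

namespace IsDerivChain

variable {f : ℕ → ℝ → ℝ}

lemma abs_sub_le_mul (hf : IsDerivChain f) {α B : ℝ} (hα : α ≤ 1)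
    (hB : ∀ t ∈ Set.Icc 0 α, |f 1 t| ≤ B) : ∀ t ∈ Set.Icc 0 α, |f 0 t - f 0 0| ≤ B * t := by
  intro t ht
  have := (convex_Icc 0 α).norm_image_sub_le_of_norm_hasDerivWithin_le (f := f 0) (f' := f 1)
    (fun x hx => (hf 0 x ⟨hx.1, hx.2.trans hα⟩).mono (Set.Icc_subset_Icc_right hα)) hB
    (⟨le_rfl, ht.1.trans ht.2⟩ : (0 : ℝ) ∈ Set.Icc 0 α) ht
  simpa [Real.norm_eq_abs, abs_of_nonneg ht.1] using this

lemma norm_oneSided_integrand_le (hf : IsDerivChain f) {α B : ℝ} (hα : α ≤ 1)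
    (hB : ∀ t ∈ Set.Icc 0 α, |f 1 t| ≤ B) (lam : ℝ) : ∀ t ∈ Set.Ioc 0 α,
    ‖(Complex.exp (Complex.I * lam * f 0 t) - Complex.exp (Complex.I * lam * f 0 0)) / (t : ℂ)‖ ≤
      |lam| * B := by
  intro t ht
  rw [norm_div, Complex.norm_real, Real.norm_of_nonneg ht.1.le, div_le_iff₀ ht.1,
    mul_assoc |lam|]
  exact (norm_cexp_phase_sub_le _ _ _).trans
    (mul_le_mul_of_nonneg_left (hf.abs_sub_le_mul hα hB t ⟨ht.1.le, ht.2⟩) (abs_nonneg _))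

lemma intervalIntegrable_oneSided (hf : IsDerivChain f) (lam : ℝ) :
    IntervalIntegrable (fun t : ℝ => (Complex.exp (Complex.I * lam * f 0 t) -
      Complex.exp (Complex.I * lam * f 0 0)) / (t : ℂ)) MeasureTheory.volume 0 1 := by
  obtain ⟨B, -, hB⟩ := hf.exists_bound 1
  refine intervalIntegrable_of_continuousOn_Ioc_of_bound ?_
    (hf.norm_oneSided_integrand_le le_rfl hB lam)
  refine (((continuousOn_cexp_phase (hf.continuousOn 0) lam).mono Set.Ioc_subset_Icc_self).sub
    continuousOn_const).div Complex.continuous_ofReal.continuousOn ?_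
  intro t ht
  exact_mod_cast ht.1.ne'

lemma oneSided_eq_add (hf : IsDerivChain f) (lam : ℝ) {α : ℝ} (hα : 0 < α) (hα1 : α ≤ 1) :
    oneSided (f 0) lam = (∫ t in (0 : ℝ)..α, (Complex.exp (Complex.I * lam * f 0 t) -
        Complex.exp (Complex.I * lam * f 0 0)) / t) +
      ∫ t in α..(1 : ℝ), (Complex.exp (Complex.I * lam * f 0 t) -
        Complex.exp (Complex.I * lam * f 0 0)) / t := by
  have h := hf.intervalIntegrable_oneSided lam
  refine (intervalIntegral.integral_add_adjacent_intervals (h.mono_set ?_) (h.mono_set ?_)).symm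
  · rw [Set.uIcc_of_le hα.le, Set.uIcc_of_le zero_le_one]; exact Set.Icc_subset_Icc_right hα1
  · rw [Set.uIcc_of_le hα1, Set.uIcc_of_le zero_le_one]; exact Set.Icc_subset_Icc_left hα.le

/-! ### Flat phases -/

lemma oneSided_isBigO_of_flat (hf : IsDerivChain f) (hflat : ∀ j, 1 ≤ j → f j 0 = 0) {k : ℕ}
    (hk : 1 ≤ k) {s : ℝ} (hs : 1 < s) {K : ℝ} (hK : 0 < K)
    (hfK : ∀ᶠ n : ℕ in atTop, ∀ t ∈ Set.Icc (0 : ℝ) 1,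
      |f n t| ≤ K ^ (n + 1) * (n.factorial : ℝ) * Q k s n ^ n) :
    oneSided (f 0) =O[atTop] (fun lam : ℝ => Real.log^[k + 2] lam) := by
  obtain ⟨c₀, hc₀, B, hB, hdecay⟩ := hf.exists_decay hflat hk hs hK hfK
  set c := min c₀ 1
  have hc : 0 < c := lt_min hc₀ one_pos
  have hc1 : c ≤ 1 := min_le_right _ _
  -- The part on [0, α] gives B. The part on [α, 1] gives -2 log α = -2 log c + 2(s - 1) log y,
  -- where log y ≤ 3 log^{(k+2)} λ.
  refine IsBigO.of_bound (B - 2 * Real.log c + 6 * (s - 1)) ?_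
  have hceil : Tendsto (fun lam : ℝ => ⌈Real.log lam⌉₊) atTop atTop :=
    tendsto_nat_ceil_atTop.comp Real.tendsto_log_atTop
  filter_upwards [hceil.eventually hdecay, eventually_ge_atTop (Real.exp^[k + 2] 1)]
    with lam hdec hlam
  have hlam0 : 0 < lam := pos_of_exp_iterate_one_le hlam
  set n := ⌈Real.log lam⌉₊
  have hlog : Real.exp^[k + 1] 1 ≤ Real.log lam := exp_iterate_le_log hlam0 hlam
  have hlog1 : 1 ≤ Real.log lam := (one_le_exp_iterate_one _).trans hlog
  have hnlog : Real.log lam ≤ n := Nat.le_ceil _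
  have hn3 : (n : ℝ) + 1 ≤ 3 * Real.log lam := by
    have := Nat.ceil_lt_add_one (by linarith : 0 ≤ Real.log lam)
    linarith
  have hn1 : Real.exp^[k + 1] 1 ≤ (n : ℝ) + 1 := by linarith
  set y := Real.log^[k] ((n : ℝ) + 1)
  have hy1 : 1 ≤ y := one_le_log_iterate (exp_iterate_one_le_of_le k.le_succ hn1)
  have hyL : Real.log y ≤ 3 * Real.log^[k + 2] lam := by
    have h1 := log_iterate_le_log_iterate hn1 hn3
    rw [Function.iterate_succ_apply'] at h1
    refine h1.trans ?_
    have := log_iterate_mul_le hlog (by norm_num : (1 : ℝ) ≤ 3)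
    exact this
  have hL1 : 1 ≤ Real.log^[k + 2] lam := one_le_log_iterate hlam
  set α := c * y ^ (1 - s)
  have hα : 0 < α := mul_pos hc (Real.rpow_pos_of_pos (by linarith) _)
  have hα1 : α ≤ 1 :=
    mul_le_one₀ hc1 (Real.rpow_nonneg (by linarith) _)
      (Real.rpow_le_one_of_one_le_of_nonpos hy1 (by linarith))
  have hf1 : ∀ t ∈ Set.Icc 0 α, |f 1 t| ≤ B / lam := by
    intro t ht
    refine (hdec t ⟨ht.1, ht.2.trans hα1⟩ (ht.2.trans ?_)).trans ?_
    · exact mul_le_mul_of_nonneg_right (min_le_left _ _) (Real.rpow_nonneg (by linarith) _)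
    · rw [div_eq_mul_inv]
      refine mul_le_mul_of_nonneg_left ?_ hB.le
      rw [Real.exp_neg]
      exact inv_anti₀ hlam0 ((Real.log_le_iff_le_exp hlam0).1 hnlog)
  rw [hf.oneSided_eq_add lam hα hα1, Real.norm_of_nonneg (by linarith : 0 ≤ Real.log^[k + 2] lam)]
  have h1 := intervalIntegral.norm_integral_le_of_norm_le_const
    (fun t ht => hf.norm_oneSided_integrand_le hα1 hf1 lam t (by rwa [Set.uIoc_of_le hα.le] at ht))
  have h2 := norm_integral_div_id_le (F := fun t => Complex.exp (Complex.I * lam * f 0 t) -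
    Complex.exp (Complex.I * lam * f 0 0)) (B := 2) hα hα1 (fun t _ => by
      refine (norm_sub_le _ _).trans ?_
      rw [norm_cexp_phase, norm_cexp_phase]; norm_num)
  have h3 : |lam| * (B / lam) * |α - 0| ≤ B := by
    rw [abs_of_pos hlam0, sub_zero, abs_of_pos hα, mul_div_cancel₀ _ hlam0.ne']
    nlinarith
  have h4 : Real.log α = Real.log c + (1 - s) * Real.log y := by
    rw [Real.log_mul hc.ne' (Real.rpow_pos_of_pos (by linarith) _).ne',
      Real.log_rpow (by linarith)]
  have h5 : Real.log c ≤ 0 := Real.log_nonpos hc.le hc1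
  refine (norm_add_le _ _).trans ((add_le_add (h1.trans h3) h2).trans ?_)
  rw [h4]
  nlinarith

/-! ### Phases vanishing to finite order -/

/-- Integrate down from order d, discarding the factors 1/(n + 1). Stopping at j = 1 leaves the
value of the phase at 0 free. -/
lemma abs_sub_monomial_le (hf : IsDerivChain f) {d : ℕ} (hd : ∀ j, 1 ≤ j → j < d → f j 0 = 0)
    {C : ℝ} (hC : ∀ t ∈ Set.Icc (0 : ℝ) 1, |f (d + 1) t| ≤ C) (i : ℕ) :
    ∀ j, 1 ≤ j → i + j = d → ∀ t ∈ Set.Icc (0 : ℝ) 1,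
      |f j t - f d 0 * t ^ i / i.factorial| ≤ C * t ^ (i + 1) := by
  have hC0 : 0 ≤ C := (abs_nonneg _).trans (hC 0 ⟨le_rfl, zero_le_one⟩)
  induction i with
  | zero =>
    intro j hj hjd
    obtain rfl : j = d := by omega
    refine abs_le_of_abs_deriv_le_pow (g' := f (j + 1)) (fun t ht => ?_) (by simp) hC0
      (by simpa using hC)
    simpa using (hf j t ht).sub_const (f j 0)
  | succ i ih =>
    intro j hj hjd
    refine abs_le_of_abs_deriv_le_pow (fun t ht => ?_)
      (by simp [hd j hj (by omega)]) hC0 (ih (j + 1) (by omega) (by omega))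
    refine (hf j t ht).sub ?_
    refine HasDerivAt.hasDerivWithinAt ?_
    refine (((hasDerivAt_pow (i + 1) t).const_mul (f d 0)).div_const
      ((i + 1).factorial : ℝ)).congr_deriv ?_
    have : (i.factorial : ℝ) ≠ 0 := by positivity
    rw [Nat.factorial_succ]
    push_cast
    field_simp

/-- Size of the first two derivatives of a phase vanishing to order exactly `e + 1`. -/
lemma exists_finite_order_bounds (hf : IsDerivChain f) {e : ℕ}
    (hd : ∀ j, 1 ≤ j → j < e + 1 → f j 0 = 0) (hne : f (e + 1) 0 ≠ 0) :
    ∃ c > 0, ∃ C > 0, ∃ η ∈ Set.Ioc (0 : ℝ) 1,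
      (∀ t ∈ Set.Icc (0 : ℝ) 1, |f 1 t| ≤ C * t ^ e ∧ |t * f 2 t| ≤ C * t ^ e) ∧
      ∀ t ∈ Set.Icc 0 η, c * t ^ e ≤ |f 1 t| := by
  obtain ⟨C, hC0, hC⟩ := hf.exists_bound (e + 1 + 1)
  set b := f (e + 1) 0 with hb
  have hb0 : 0 < |b| := abs_pos.2 hne
  have hmono : ∀ (i : ℕ) (t : ℝ), 0 ≤ t → |b * t ^ i / i.factorial| ≤ |b| * t ^ i := by
    intro i t ht
    rw [abs_div, abs_mul, abs_of_nonneg (pow_nonneg ht i), Nat.abs_cast]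
    exact div_le_self (by positivity) (by exact_mod_cast i.factorial_pos)
  have hup : ∀ i j, 1 ≤ j → i + j = e + 1 → ∀ t ∈ Set.Icc (0 : ℝ) 1,
      |f j t| ≤ (|b| + C) * t ^ i := by
    intro i j hj hij t ht
    have h1 := hf.abs_sub_monomial_le hd hC i j hj hij t ht
    have h2 := hmono i t ht.1
    have h3 : t ^ (i + 1) ≤ t ^ i := pow_le_pow_of_le_one ht.1 ht.2 i.le_succ
    have h4 := abs_add_le (f j t - b * t ^ i / i.factorial) (b * t ^ i / i.factorial)
    rw [sub_add_cancel] at h4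
    nlinarith
  have hfac : (0 : ℝ) < e.factorial := by positivity
  -- η is chosen so that on [0, η] the Taylor remainder is at most half of the leading term |b| t^e
  -- / e!.
  refine ⟨|b| / (2 * e.factorial), by positivity, |b| + C, by positivity,
    min 1 (|b| / (2 * e.factorial * C)), ⟨lt_min one_pos (by positivity), min_le_left _ _⟩,
    fun t ht => ⟨hup e 1 le_rfl rfl t ht, ?_⟩, fun t ht => ?_⟩
  · rw [abs_mul, abs_of_nonneg ht.1]
    rcases e with _ | e
    · have := hC t ht
      have h0 := abs_nonneg (f 2 t)
      simp only [zero_add, Nat.reduceAdd, pow_zero, mul_one] at this ⊢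
      nlinarith [ht.1, ht.2]
    · have := mul_le_mul_of_nonneg_left (hup e 2 (by omega) (by omega) t ht) ht.1
      refine this.trans (le_of_eq ?_)
      ring
  · have ht1 : t ∈ Set.Icc (0 : ℝ) 1 := ⟨ht.1, ht.2.trans (min_le_left _ _)⟩
    have h1 := hf.abs_sub_monomial_le hd hC e 1 le_rfl rfl t ht1
    have h2 : C * t ≤ |b| / (2 * e.factorial) := by
      have := ht.2.trans (min_le_right _ _)
      rw [le_div_iff₀ (by positivity)] at this ⊢
      linarith
    have h3 : |b * t ^ e / e.factorial| = |b| / e.factorial * t ^ e := by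
      rw [abs_div, abs_mul, abs_of_nonneg (pow_nonneg ht.1 e), Nat.abs_cast]; ring
    have h4 := abs_sub_abs_le_abs_sub (b * t ^ e / e.factorial) (f 1 t)
    rw [abs_sub_comm, h3] at h4
    have h5 : C * t ^ (e + 1) ≤ |b| / (2 * e.factorial) * t ^ e := by
      rw [pow_succ', ← mul_assoc]
      exact mul_le_mul_of_nonneg_right h2 (pow_nonneg ht.1 e)
    have h6 : |b| / e.factorial * t ^ e = 2 * (|b| / (2 * e.factorial) * t ^ e) := by
      field_simp
    linarith

/-- Integration by parts away from the critical point. -/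
lemma norm_integral_le_of_deriv_bounds (hf : IsDerivChain f) {e : ℕ} {c C α η lam : ℝ}
    (hc : 0 < c) (hC : 0 < C) (hα : 0 < α) (hαη : α ≤ η) (hη : η ≤ 1) (hlam : 0 < lam)
    (hup : ∀ t ∈ Set.Icc (0 : ℝ) 1, |f 1 t| ≤ C * t ^ e ∧ |t * f 2 t| ≤ C * t ^ e)
    (hlow : ∀ t ∈ Set.Icc 0 η, c * t ^ e ≤ |f 1 t|) :
    ‖∫ t in α..η, Complex.exp (Complex.I * lam * f 0 t) / t‖ ≤
      (2 / c + 2 * C / c ^ 2) / (lam * α ^ (e + 1)) := by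
  have hsub : Set.Icc α η ⊆ Set.Icc 0 1 := Set.Icc_subset_Icc hα.le hη
  have hg0 : ∀ t ∈ Set.Icc α η, c * t ^ (e + 1) ≤ |t * f 1 t| := by
    intro t ht
    have ht0 := hα.le.trans ht.1
    rw [abs_mul, abs_of_nonneg ht0, pow_succ', mul_left_comm]
    exact mul_le_mul_of_nonneg_left (hlow t ⟨ht0, ht.2⟩) ht0
  have hgne : ∀ t ∈ Set.Icc α η, t * f 1 t ≠ 0 := by
    intro t ht h0
    have := hg0 t ht
    have ht0 := hα.trans_le ht.1
    rw [h0, abs_zero] at this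
    exact absurd this (not_le.2 (by positivity))
  -- H' = e^{iλf}/t - R, and |R| is at most 2C/(c²λ) · t^{-e-2}, whose integral from α is O(1/(λ
  -- α^{e+1})).
  set H : ℝ → ℂ := fun t => Complex.exp (Complex.I * lam * f 0 t) /
    (Complex.I * lam * (t * f 1 t : ℝ)) with hH
  set R : ℝ → ℂ := fun t => Complex.exp (Complex.I * lam * f 0 t) * (f 1 t + t * f 2 t : ℝ) /
    (Complex.I * lam * ((t * f 1 t : ℝ) : ℂ) ^ 2) with hR
  have hden : ∀ t ∈ Set.Icc α η, Complex.I * lam * ((t * f 1 t : ℝ) : ℂ) ≠ 0 := fun t ht =>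
    mul_ne_zero (mul_ne_zero Complex.I_ne_zero (by exact_mod_cast hlam.ne'))
      (by exact_mod_cast hgne t ht)
  have hF := (continuousOn_cexp_phase (hf.continuousOn 0) lam).mono hsub
  have hf1 := (hf.continuousOn 1).mono hsub
  have hf2 := (hf.continuousOn 2).mono hsub
  have hHc : ContinuousOn H (Set.Icc α η) := by
    refine hF.div (continuousOn_const.mul ?_) hden
    exact Complex.continuous_ofReal.comp_continuousOn (continuousOn_id.mul hf1)
  have hRc : ContinuousOn R (Set.Icc α η) := by
    refine (hF.mul (Complex.continuous_ofReal.comp_continuousOn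
      (hf1.add (continuousOn_id.mul hf2)))).div
      (continuousOn_const.mul ((Complex.continuous_ofReal.comp_continuousOn
        (continuousOn_id.mul hf1)).pow 2)) fun t ht => ?_
    exact mul_ne_zero (mul_ne_zero Complex.I_ne_zero (by exact_mod_cast hlam.ne'))
      (pow_ne_zero 2 (by exact_mod_cast hgne t ht))
  have hEint : IntervalIntegrable (fun t : ℝ => Complex.exp (Complex.I * lam * f 0 t) / (t : ℂ))
      MeasureTheory.volume α η :=
    intervalIntegrable_div_id (continuousOn_cexp_phase (hf.continuousOn 0) lam) hα hαη hη
  have hRint : IntervalIntegrable R MeasureTheory.volume α η :=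
    hRc.intervalIntegrable_of_Icc hαη
  have hderiv : ∀ t ∈ Set.Ioo α η,
      HasDerivAt H (Complex.exp (Complex.I * lam * f 0 t) / t - R t) t := by
    intro t ht
    have ht' : t ∈ Set.Icc α η := ⟨ht.1.le, ht.2.le⟩
    have ht01 : t ∈ Set.Ioo (0 : ℝ) 1 := ⟨hα.trans ht.1, ht.2.trans_le hη⟩
    have h0 := (hf.hasDerivAt 0 ht01).ofReal_comp
    have h1 := ((hasDerivAt_id t).mul (hf.hasDerivAt 1 ht01)).ofReal_comp
    have := ((h0.const_mul (Complex.I * lam)).cexp).div (h1.const_mul (Complex.I * lam))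
      (hden t ht')
    refine this.congr_deriv ?_
    have ht0 : (t : ℂ) ≠ 0 := by exact_mod_cast ht01.1.ne'
    have hf10 : (f 1 t : ℂ) ≠ 0 := by
      have := hgne t ht'
      exact_mod_cast (mul_ne_zero_iff.1 this).2
    have hl0 : (lam : ℂ) ≠ 0 := by exact_mod_cast hlam.ne'
    have hI := Complex.I_ne_zero
    simp only [hR, Pi.mul_apply, id, zero_add, Nat.reduceAdd, one_mul]
    push_cast
    field_simp
  have hFTC := intervalIntegral.integral_eq_sub_of_hasDerivAt_of_le hαη hHc hderiv
    (hEint.sub hRint)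
  rw [intervalIntegral.integral_sub hEint hRint, sub_eq_iff_eq_add] at hFTC
  rw [hFTC]
  have hHb : ∀ t ∈ Set.Icc α η, ‖H t‖ ≤ 1 / (c * (lam * α ^ (e + 1))) := by
    intro t ht
    simp only [hH]
    rw [norm_div, norm_cexp_phase, norm_mul, norm_mul, Complex.norm_I, one_mul, Complex.norm_real,
      Complex.norm_real, Real.norm_of_nonneg hlam.le, Real.norm_eq_abs]
    refine one_div_le_one_div_of_le (by positivity) ?_
    have h1 := hg0 t ht
    have h2 : α ^ (e + 1) ≤ t ^ (e + 1) := pow_le_pow_left₀ hα.le ht.1 _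
    calc c * (lam * α ^ (e + 1)) = lam * (c * α ^ (e + 1)) := by ring
      _ ≤ lam * (c * t ^ (e + 1)) := by gcongr
      _ ≤ _ := by gcongr
  have hRb : ‖∫ t in α..η, R t‖ ≤ 2 * C / c ^ 2 / (lam * α ^ (e + 1)) := by
    have h0 : (0 : ℝ) ∉ Set.uIcc α η := by
      rw [Set.uIcc_of_le hαη]; exact fun h => absurd h.1 (not_le.2 hα)
    have hz : (-(e : ℤ) - 2) ≠ -1 := by omega
    refine (intervalIntegral.norm_integral_le_of_norm_le
      (g := fun t => 2 * C / (c ^ 2 * lam) * t ^ (-(e : ℤ) - 2)) hαη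
      (Eventually.of_forall fun t ht => ?_) ?_).trans ?_
    · have ht' : t ∈ Set.Icc α η := ⟨ht.1.le, ht.2⟩
      have ht0 : 0 < t := hα.trans ht.1
      obtain ⟨h1, h2⟩ := hup t (hsub ht')
      simp only [hR]
      rw [norm_div, norm_mul, norm_cexp_phase, norm_mul, norm_mul, norm_pow, Complex.norm_I,
        one_mul, one_mul, Complex.norm_real, Complex.norm_real, Complex.norm_real,
        Real.norm_of_nonneg hlam.le, Real.norm_eq_abs, Real.norm_eq_abs]
      have h3 : |f 1 t + t * f 2 t| ≤ 2 * C * t ^ e := by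
        have := abs_add_le (f 1 t) (t * f 2 t)
        linarith
      have h4 : (c * t ^ (e + 1)) ^ 2 ≤ |t * f 1 t| ^ 2 :=
        pow_le_pow_left₀ (by positivity) (hg0 t ht') 2
      calc _ ≤ 2 * C * t ^ e / (lam * (c * t ^ (e + 1)) ^ 2) := by gcongr
        _ = _ := by
          rw [zpow_sub₀ ht0.ne', zpow_neg, zpow_natCast]
          norm_cast
          field_simp
          ring
    · exact (intervalIntegral.intervalIntegrable_zpow (Or.inr h0)).const_mul _
    · rw [intervalIntegral.integral_const_mul, integral_zpow (Or.inr ⟨hz, h0⟩)]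
      have hη0 : 0 < η := hα.trans_le hαη
      have e1 : ∀ t : ℝ, t ^ (-(e : ℤ) - 2 + 1) = (t ^ (e + 1))⁻¹ := by
        intro t
        rw [show (-(e : ℤ) - 2 + 1) = -((e + 1 : ℕ) : ℤ) by push_cast; ring, zpow_neg, zpow_natCast]
      rw [e1, e1]
      push_cast
      have h1 : ((η ^ (e + 1))⁻¹ - (α ^ (e + 1))⁻¹) / (-(e : ℝ) - 2 + 1) ≤ (α ^ (e + 1))⁻¹ := by
        rw [show (-(e : ℝ) - 2 + 1) = -((e : ℝ) + 1) by ring, div_neg, ← neg_div, neg_sub]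
        have hp : 0 < (η ^ (e + 1))⁻¹ := by positivity
        have hq : 0 < (α ^ (e + 1))⁻¹ := by positivity
        rw [div_le_iff₀ (by positivity)]
        nlinarith [(Nat.cast_nonneg e : (0 : ℝ) ≤ e)]
      calc _ ≤ 2 * C / (c ^ 2 * lam) * (α ^ (e + 1))⁻¹ := by gcongr
        _ = _ := by field_simp
  calc ‖H η - H α + ∫ t in α..η, R t‖ ≤ ‖H η‖ + ‖H α‖ + ‖∫ t in α..η, R t‖ :=
        (norm_add_le _ _).trans (add_le_add_left (norm_sub_le _ _) _)
    _ ≤ 1 / (c * (lam * α ^ (e + 1))) + 1 / (c * (lam * α ^ (e + 1))) +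
        2 * C / c ^ 2 / (lam * α ^ (e + 1)) := by
        gcongr
        · exact hHb η ⟨hαη, le_rfl⟩
        · exact hHb α ⟨le_rfl, hαη⟩
    _ = _ := by field_simp; ring

/-- Cut at α = λ^{-1/(e+1)}, where λ α^{e+1} = 1. Below α the phase barely moves; on [α, η]
integration by parts gives O(1); [η, 1] is trivial. The subtracted constant, integrated over [α, 1],
produces the logarithm. -/
lemma oneSided_add_log_isBigO (hf : IsDerivChain f) {e : ℕ}
    (hd : ∀ j, 1 ≤ j → j < e + 1 → f j 0 = 0) (hne : f (e + 1) 0 ≠ 0) :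
    (fun lam : ℝ => oneSided (f 0) lam + (Real.log lam / (e + 1) : ℝ) *
      Complex.exp (Complex.I * lam * f 0 0)) =O[atTop] (fun _ => (1 : ℝ)) := by
  obtain ⟨c, hc, C, hC, η, hη, hup, hlow⟩ := hf.exists_finite_order_bounds hd hne
  refine IsBigO.of_bound (C + (2 / c + 2 * C / c ^ 2) + -Real.log η) ?_
  have hαlim : Tendsto (fun lam : ℝ => lam ^ (-(1 / ((e : ℝ) + 1)))) atTop (𝓝 0) :=
    tendsto_rpow_neg_atTop (by positivity)
  filter_upwards [hαlim.eventually (ge_mem_nhds hη.1), eventually_gt_atTop 0] with lam hαη hlam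
  set α := lam ^ (-(1 / ((e : ℝ) + 1))) with hαdef
  have hα : 0 < α := Real.rpow_pos_of_pos hlam _
  have hα1 : α ≤ 1 := hαη.trans hη.2
  have hαpow : lam * α ^ (e + 1) = 1 := by
    have he : (e : ℝ) + 1 ≠ 0 := by positivity
    rw [hαdef, ← Real.rpow_natCast, ← Real.rpow_mul hlam.le]
    push_cast
    rw [neg_mul, one_div_mul_cancel he, Real.rpow_neg_one, mul_inv_cancel₀ hlam.ne']
  have hlogα : Real.log α = -(Real.log lam / (e + 1)) := by
    rw [hαdef, Real.log_rpow hlam]; ring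
  have hcont := continuousOn_cexp_phase (hf.continuousOn 0) lam
  have hsplit : ∫ t in α..(1 : ℝ), (Complex.exp (Complex.I * lam * f 0 t) -
        Complex.exp (Complex.I * lam * f 0 0)) / t =
      (∫ t in α..η, Complex.exp (Complex.I * lam * f 0 t) / t) +
      (∫ t in η..(1 : ℝ), Complex.exp (Complex.I * lam * f 0 t) / t) -
      (Real.log lam / (e + 1) : ℝ) * Complex.exp (Complex.I * lam * f 0 0) := by
    simp only [sub_div]
    rw [intervalIntegral.integral_sub (intervalIntegrable_div_id hcont hα hα1 le_rfl)
      (intervalIntegrable_div_id continuousOn_const hα hα1 le_rfl), integral_const_div_id _ hα,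
      intervalIntegral.integral_add_adjacent_intervals
        (intervalIntegrable_div_id hcont hα hαη hη.2)
        (intervalIntegrable_div_id hcont hη.1 hη.2 le_rfl), hlogα]
    push_cast
    ring
  rw [hf.oneSided_eq_add lam hα hα1, hsplit, add_assoc, sub_add_cancel, norm_one, mul_one]
  have h1 : ‖∫ t in (0 : ℝ)..α, (Complex.exp (Complex.I * lam * f 0 t) -
        Complex.exp (Complex.I * lam * f 0 0)) / t‖ ≤ C := by
    have hb : ∀ t ∈ Set.Icc 0 α, |f 1 t| ≤ C * α ^ e := fun t ht =>
      (hup t ⟨ht.1, ht.2.trans hα1⟩).1.trans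
        (mul_le_mul_of_nonneg_left (pow_le_pow_left₀ ht.1 ht.2 e) hC.le)
    refine (intervalIntegral.norm_integral_le_of_norm_le_const
      (fun t ht => hf.norm_oneSided_integrand_le hα1 hb lam t
        (by rwa [Set.uIoc_of_le hα.le] at ht))).trans (le_of_eq ?_)
    rw [abs_of_pos hlam, sub_zero, abs_of_pos hα]
    linear_combination C * hαpow
  have h2 := hf.norm_integral_le_of_deriv_bounds hc hC hα hαη hη.2 hlam hup hlow
  rw [hαpow, div_one] at h2
  have h3 := norm_integral_div_id_le (F := fun t => Complex.exp (Complex.I * lam * f 0 t)) (B := 1)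
    hη.1 hη.2 (fun t _ => (norm_cexp_phase _ _).le)
  rw [one_mul] at h3
  exact (norm_add_le _ _).trans
    ((add_le_add h1 ((norm_add_le _ _).trans (add_le_add h2 h3))).trans_eq (by ring))

end IsDerivChain

/-! ### The upper bound -/

lemma hasDerivWithinAt_iteratedDerivWithin {ψ : ℝ → ℝ} (hψ : ContDiffOn ℝ ∞ ψ I) (n : ℕ) {t : ℝ}
    (ht : t ∈ I) :
    HasDerivWithinAt (iteratedDerivWithin n ψ I) (iteratedDerivWithin (n + 1) ψ I t) I t := by
  have hI : UniqueDiffOn ℝ I := uniqueDiffOn_Icc (by norm_num)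
  rw [iteratedDerivWithin_succ]
  exact (hψ.differentiableOn_iteratedDerivWithin (by exact_mod_cast WithTop.coe_lt_top n) hI t
    ht).hasDerivWithinAt

lemma isDerivChain_right {ψ : ℝ → ℝ} (hψ : ContDiffOn ℝ ∞ ψ I) :
    IsDerivChain (fun n => iteratedDerivWithin n ψ I) := fun n _ ht =>
  (hasDerivWithinAt_iteratedDerivWithin hψ n ⟨by linarith [ht.1], ht.2⟩).mono
    (Set.Icc_subset_Icc_left (by norm_num))

lemma isDerivChain_left {ψ : ℝ → ℝ} (hψ : ContDiffOn ℝ ∞ ψ I) :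
    IsDerivChain (fun n t => (-1) ^ n * iteratedDerivWithin n ψ I (-t)) := by
  intro n t ht
  have hmaps : Set.MapsTo (fun t : ℝ => -t) (Set.Icc 0 1) I := fun x hx =>
    ⟨by linarith [hx.2], by linarith [hx.1]⟩
  have h := (hasDerivWithinAt_iteratedDerivWithin hψ n (hmaps ht)).comp t
    (hasDerivAt_neg t).hasDerivWithinAt hmaps
  refine (h.const_mul ((-1 : ℝ) ^ n)).congr_deriv ?_
  simp only [pow_succ]
  ring

lemma tendsto_truncated {ψ : ℝ → ℝ} {f g : ℕ → ℝ → ℝ} (hf : IsDerivChain f) (hg : IsDerivChain g)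
    (hf0 : f 0 = ψ) (hg0 : g 0 = fun t => ψ (-t)) (lam : ℝ) :
    Tendsto (truncated ψ lam) (𝓝[>] 0) (𝓝 (oneSided (f 0) lam - oneSided (g 0) lam)) := by
  have hlim : ∀ {h : ℕ → ℝ → ℝ}, IsDerivChain h → Tendsto (fun ε : ℝ => ∫ t in ε..(1 : ℝ),
      (Complex.exp (Complex.I * lam * h 0 t) - Complex.exp (Complex.I * lam * h 0 0)) / (t : ℂ))
      (𝓝[>] 0) (𝓝 (oneSided (h 0) lam)) := by
    intro h hh
    have hint := (intervalIntegrable_iff' (by simp)).1 (hh.intervalIntegrable_oneSided lam)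
    have := intervalIntegral.continuousOn_primitive_interval_left hint 0 (by simp)
    rw [Set.uIcc_of_le zero_le_one] at this
    exact this.tendsto.mono_left (nhdsWithin_le_of_mem (Icc_mem_nhdsGT one_pos))
  refine ((hlim hf).sub (hlim hg)).congr' ?_
  filter_upwards [Ioc_mem_nhdsGT one_pos] with ε hε
  have hneg : ∫ t in (-1 : ℝ)..(-ε), Complex.exp (Complex.I * lam * ψ t) / t =
      ∫ t in ε..(1 : ℝ), -(Complex.exp (Complex.I * lam * g 0 t) / t) := by
    rw [← intervalIntegral.integral_comp_neg]
    refine intervalIntegral.integral_congr fun t _ => ?_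
    simp [hg0, div_neg]
  rw [truncated, hneg, intervalIntegral.integral_neg]
  have hsub : ∀ {h : ℕ → ℝ → ℝ}, IsDerivChain h → ∫ t in ε..(1 : ℝ),
      (Complex.exp (Complex.I * lam * h 0 t) - Complex.exp (Complex.I * lam * h 0 0)) / (t : ℂ) =
      (∫ t in ε..(1 : ℝ), Complex.exp (Complex.I * lam * h 0 t) / t) -
      ∫ t in ε..(1 : ℝ), Complex.exp (Complex.I * lam * h 0 0) / t := by
    intro h hh
    simp only [sub_div]
    exact intervalIntegral.integral_sub
      (intervalIntegrable_div_id (continuousOn_cexp_phase (hh.continuousOn 0) lam) hε.1 hε.2 le_rfl)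
      (intervalIntegrable_div_id continuousOn_const hε.1 hε.2 le_rfl)
  have h00 : g 0 0 = f 0 0 := by simp [hf0, hg0]
  rw [hsub hf, hsub hg, h00, hf0]
  ring

lemma m_eq {ψ : ℝ → ℝ} (hψ : ContDiffOn ℝ ∞ ψ I) (lam : ℝ) :
    Tendsto (truncated ψ lam) (𝓝[>] 0) (𝓝 (m ψ lam)) ∧
      m ψ lam = oneSided ψ lam - oneSided (fun t => ψ (-t)) lam := by
  have h := tendsto_truncated (isDerivChain_right hψ) (isDerivChain_left hψ)
    (iteratedDerivWithin_zero) (by simp [iteratedDerivWithin_zero]) lam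
  rw [m, h.limUnder_eq]
  refine ⟨h, ?_⟩
  simp [iteratedDerivWithin_zero]

lemma one_isBigO_log_iterate (j : ℕ) :
    (fun _ : ℝ => (1 : ℝ)) =O[atTop] (fun lam : ℝ => Real.log^[j] lam) := by
  refine IsBigO.of_bound 1 ?_
  filter_upwards [eventually_ge_atTop (Real.exp^[j] 1)] with lam hlam
  have := one_le_log_iterate hlam
  rwa [one_mul, norm_one, Real.norm_of_nonneg (by linarith)]

/-- Reflection only changes signs of derivatives at 0, so both sides have the same order of
vanishing and identical logarithmic terms. -/
lemma m_isBigO {k : ℕ} (hk : 1 ≤ k) {s : ℝ} (hs : 1 < s) {ψ : ℝ → ℝ} (hψ : RefinedGevrey k s ψ) :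
    m ψ =O[atTop] (fun lam : ℝ => Real.log^[k + 2] lam) := by
  obtain ⟨hsmooth, K, hK, hbound⟩ := hψ
  have hf := isDerivChain_right hsmooth
  have hg := isDerivChain_left hsmooth
  have hf0 : iteratedDerivWithin 0 ψ I = ψ := iteratedDerivWithin_zero
  have hm : m ψ = fun lam => oneSided ψ lam - oneSided (fun t => ψ (-t)) lam :=
    funext fun lam => (m_eq hsmooth lam).2
  rw [hm]
  by_cases hflat : ∀ j, 1 ≤ j → iteratedDerivWithin j ψ I 0 = 0
  · have h1 := hf.oneSided_isBigO_of_flat hflat hk hs hK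
      (hbound.mono fun n hn t ht => hn t ⟨by linarith [ht.1], ht.2⟩)
    have h2 := hg.oneSided_isBigO_of_flat (fun j hj => by simp [hflat j hj]) hk hs hK
      (hbound.mono fun n hn t ht => by
        simpa [abs_mul] using hn (-t) ⟨by linarith [ht.2], by linarith [ht.1]⟩)
    simp only [hf0, pow_zero, one_mul] at h1 h2
    exact h1.sub h2
  · push Not at hflat
    obtain ⟨e, ⟨he1, hene⟩, hmin⟩ := WellFounded.has_min (wellFounded_lt (α := ℕ))
      {j | 1 ≤ j ∧ iteratedDerivWithin j ψ I 0 ≠ 0} hflat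
    obtain ⟨e, rfl⟩ := Nat.exists_eq_add_of_le' he1
    have hd : ∀ j, 1 ≤ j → j < e + 1 → iteratedDerivWithin j ψ I 0 = 0 := fun j hj hje => by
      by_contra hne
      exact hmin j ⟨hj, hne⟩ hje
    have h1 := hf.oneSided_add_log_isBigO hd hene
    have h2 := hg.oneSided_add_log_isBigO (fun j hj hje => by simp [hd j hj hje])
      (by simpa using hene)
    simp only [hf0, pow_zero, one_mul, neg_zero] at h1 h2
    refine ((h1.sub h2).trans (one_isBigO_log_iterate (k + 2))).congr_left fun lam => ?_
    ring

/-! ### The extremal phase belongs to the refined Gevrey class -/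

/-- The holomorphic extension of `t ↦ exp (-E_k(t^{-a}))` to the slit plane. -/
noncomputable def complexPhase (k : ℕ) (a : ℝ) (z : ℂ) : ℂ :=
  Complex.exp (-(Complex.exp^[k] (Complex.exp (-(a : ℂ) * Complex.log z))))

lemma cexp_iterate_ofReal (j : ℕ) (u : ℝ) :
    Complex.exp^[j] (u : ℂ) = ((Real.exp^[j] u : ℝ) : ℂ) := by
  induction j with
  | zero => simp
  | succ j ih => rw [Function.iterate_succ_apply', Function.iterate_succ_apply', ih,
      Complex.ofReal_exp]

lemma norm_cexp_sub_exp_le {w : ℂ} {u : ℝ} (h : ‖w - u‖ ≤ 1) :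
    ‖Complex.exp w - (Real.exp u : ℝ)‖ ≤ Real.exp u * (2 * ‖w - u‖) := by
  have : Complex.exp w - (Real.exp u : ℝ) = (Real.exp u : ℝ) * (Complex.exp (w - u) - 1) := by
    rw [mul_sub, Complex.ofReal_exp, ← Complex.exp_add, mul_one, add_sub_cancel]
  rw [this, norm_mul, Complex.norm_real, Real.norm_of_nonneg (Real.exp_pos u).le]
  exact mul_le_mul_of_nonneg_left (Complex.norm_exp_sub_one_le h) (Real.exp_pos u).le

/-- An exponential near a real U multiplies a small error by at most 2e^U. The induction asks for
the tolerance ε/(2e^U) one level down. -/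
lemma norm_cexp_iterate_sub_le {w : ℂ} {u : ℝ} (hu : 1 ≤ u) (j : ℕ) {ε : ℝ} (hε : ε ≤ 1)
    (h : 2 ^ j * (∏ i ∈ Finset.Ico 1 (j + 1), Real.exp^[i] u) * ‖w - u‖ ≤ ε) :
    ‖Complex.exp^[j] w - (Real.exp^[j] u : ℝ)‖ ≤ ε := by
  induction j generalizing ε with
  | zero => simpa using h
  | succ j ih =>
    set U := Real.exp^[j] u with hU
    have hE : Real.exp^[j + 1] u = Real.exp U := Function.iterate_succ_apply' _ _ _
    have hE1 : 1 ≤ Real.exp U := hE ▸ one_le_exp_iterate (j + 1) hu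
    rw [Finset.prod_Ico_succ_top (by omega), hE] at h
    have h1 : ‖Complex.exp^[j] w - (U : ℂ)‖ ≤ ε / (2 * Real.exp U) := by
      refine ih ?_ ?_
      · rw [div_le_one (by positivity)]; linarith
      · rw [le_div_iff₀ (by positivity)]
        refine le_trans (le_of_eq ?_) h
        ring
    have h2 : ‖Complex.exp^[j] w - (U : ℂ)‖ ≤ 1 :=
      h1.trans (by rw [div_le_one (by positivity)]; linarith)
    rw [Function.iterate_succ_apply', hE]
    refine (norm_cexp_sub_exp_le h2).trans ?_
    calc _ ≤ Real.exp U * (2 * (ε / (2 * Real.exp U))) := by gcongr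
      _ = ε := by field_simp

lemma norm_cexp_neg_mul_log_sub_one_le {a : ℝ} (ha : 0 ≤ a) {η : ℂ} (hη : ‖η‖ ≤ 1 / 2)
    (haη : 3 / 2 * a * ‖η‖ ≤ 1) :
    ‖Complex.exp (-(a : ℂ) * Complex.log (1 + η)) - 1‖ ≤ 3 * a * ‖η‖ := by
  have h1 := Complex.norm_log_one_add_half_le_self hη
  have h2 : ‖-(a : ℂ) * Complex.log (1 + η)‖ ≤ 3 / 2 * a * ‖η‖ := by
    rw [norm_mul, norm_neg, Complex.norm_real, Real.norm_of_nonneg ha]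
    calc _ ≤ a * (3 / 2 * ‖η‖) := by gcongr
      _ = _ := by ring
  refine (Complex.norm_exp_sub_one_le (h2.trans haη)).trans ?_
  linarith

lemma rpow_neg_identities {s t : ℝ} (hs : 1 < s) (ht : 0 < t) (ht1 : t ≤ 1) :
    1 ≤ t ^ (-(1 / (s - 1))) ∧ (t ^ (-(1 / (s - 1)))) ^ s * t = t ^ (-(1 / (s - 1))) := by
  have hs1 : 0 < s - 1 := by linarith
  refine ⟨Real.one_le_rpow_of_pos_of_le_one_of_nonpos ht ht1 (by
    have : 0 < 1 / (s - 1) := by positivity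
    linarith), ?_⟩
  rw [← Real.rpow_mul ht.le]
  nth_rewrite 2 [← Real.rpow_one t]
  rw [← Real.rpow_add ht]
  congr 1
  field_simp
  ring

/-- The radius, relative to `1 / Q`, of the discs on which the extremal phase is estimated. -/
noncomputable def discRadius (k : ℕ) (s : ℝ) : ℝ := (2 ^ k * (12 * (1 / (s - 1) + 1)))⁻¹

lemma discRadius_pos (k : ℕ) {s : ℝ} (hs : 1 < s) : 0 < discRadius k s := by
  have : 0 < s - 1 := by linarith
  rw [discRadius]
  positivity

/-- With u = t^{-1/(s-1)} one has u^s t = u, so the radius relative to t is δ/(uP), P = ∏_{1≤j<k}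
E_j(u). This is the tolerance at which k - 1 exponentials applied to z^{-1/(s-1)} move by at most
1/4. -/
lemma disc_estimates {k : ℕ} {s t : ℝ} (hs : 1 < s) (ht : 0 < t) (ht1 : t ≤ 1) {z : ℂ}
    (hz : ‖z - t‖ ≤ discRadius k s / Q k s (Real.exp^[k] (t ^ (-(1 / (s - 1)))))) :
    ‖z - t‖ < t ∧ (1 ≤ k → ‖complexPhase k (1 / (s - 1)) z‖ ≤
      Real.exp (-(Real.exp^[k] (t ^ (-(1 / (s - 1)))) / 2))) := by
  obtain ⟨hu1, hut⟩ := rpow_neg_identities hs ht ht1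
  set a := 1 / (s - 1) with ha
  have hs1 : 0 < s - 1 := by linarith
  have ha0 : 0 < a := by positivity
  set u := t ^ (-a) with hu
  set δ := discRadius k s with hδ
  have hδ0 : 0 < δ := discRadius_pos k hs
  set P := ∏ j ∈ Finset.Ico 1 k, Real.exp^[j] u with hP
  have hP1 : 1 ≤ P := Finset.prod_induction _ (fun y : ℝ => 1 ≤ y)
    (fun a b ha hb => one_le_mul_of_one_le_of_one_le ha hb) le_rfl
    (fun j _ => one_le_exp_iterate j hu1)
  rw [Q_exp_iterate, ← hP] at hz
  have hup : 0 < u ^ s := Real.rpow_pos_of_pos (by linarith) s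
  set η : ℂ := (z - t) / t with hη
  have hηnorm : ‖η‖ * (u * P) ≤ δ := by
    rw [hη, norm_div, Complex.norm_real, Real.norm_of_nonneg ht.le]
    rw [le_div_iff₀ (by positivity)] at hz
    calc ‖z - t‖ / t * (u * P) = ‖z - t‖ * (u ^ s * P) := by
          rw [div_mul_eq_mul_div, div_eq_iff ht.ne']
          linear_combination -(‖z - t‖ * P) * hut
      _ ≤ δ := hz
  have hδk : 2 ^ k * (12 * (a + 1)) * δ = 1 := by
    rw [hδ, discRadius]
    exact mul_inv_cancel₀ (by positivity)
  have h2k : (1 : ℝ) ≤ 2 ^ k := one_le_pow₀ (by norm_num)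
  have hδa : 12 * (a + 1) * δ ≤ 1 := by
    have : 0 < 12 * (a + 1) * δ := by positivity
    nlinarith
  have hη0 := norm_nonneg η
  have hηδ : ‖η‖ ≤ δ := by
    have : 1 ≤ u * P := one_le_mul_of_one_le_of_one_le hu1 hP1
    nlinarith
  have haδ : 0 < a * δ := by positivity
  have hηhalf : ‖η‖ ≤ 1 / 2 := by nlinarith
  have haη : 3 / 2 * a * ‖η‖ ≤ 1 := by nlinarith
  have ht0 : (t : ℂ) ≠ 0 := by exact_mod_cast ht.ne'
  have hzt : z = t * (1 + η) := by rw [hη]; field_simp; ring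
  refine ⟨?_, fun hk => ?_⟩
  · rw [show z - t = t * η by rw [hzt]; ring, norm_mul, Complex.norm_real,
      Real.norm_of_nonneg ht.le]
    nlinarith
  have h1η : 1 + η ≠ 0 := by
    intro h0
    have : η = -1 := by linear_combination h0
    rw [this] at hηhalf
    norm_num at hηhalf
  have hw : Complex.exp (-(a : ℂ) * Complex.log z) =
      u * Complex.exp (-(a : ℂ) * Complex.log (1 + η)) := by
    rw [hzt, Complex.log_ofReal_mul ht h1η, mul_add, Complex.exp_add, hu, Real.rpow_def_of_pos ht]
    push_cast
    ring_nf
  set w := Complex.exp (-(a : ℂ) * Complex.log z) with hwdef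
  have hwu : ‖w - u‖ ≤ u * (3 * a * ‖η‖) := by
    rw [hw, show (u : ℂ) * Complex.exp (-(a : ℂ) * Complex.log (1 + η)) - u =
      u * (Complex.exp (-(a : ℂ) * Complex.log (1 + η)) - 1) by ring, norm_mul, Complex.norm_real,
      Real.norm_of_nonneg (by linarith)]
    exact mul_le_mul_of_nonneg_left (norm_cexp_neg_mul_log_sub_one_le ha0.le hηhalf haη)
      (by linarith)
  -- The last exponential is held back: it turns the absolute error 1/4 into the relative error 1/2,
  -- so the real part stays at least x/2.
  obtain ⟨l, rfl⟩ := Nat.exists_eq_add_of_le' hk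
  have hiter : ‖Complex.exp^[l] w - (Real.exp^[l] u : ℝ)‖ ≤ 1 / 4 := by
    refine norm_cexp_iterate_sub_le hu1 l (by norm_num) ?_
    rw [← hP]
    have hl : (0 : ℝ) < 2 ^ l := by positivity
    calc 2 ^ l * P * ‖w - u‖ ≤ 2 ^ l * P * (u * (3 * a * ‖η‖)) := by gcongr
      _ = 2 ^ l * (3 * a) * (‖η‖ * (u * P)) := by ring
      _ ≤ 2 ^ l * (3 * a) * δ := by gcongr
      _ ≤ 1 / 4 := by
        rw [pow_succ] at hδk
        have : 0 < 2 ^ l * δ := by positivity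
        have : 0 < 2 ^ l * (a * δ) := by positivity
        nlinarith
  have hlast := norm_cexp_sub_exp_le (hiter.trans (by norm_num))
  rw [← Function.iterate_succ_apply' Complex.exp, ← Function.iterate_succ_apply' Real.exp] at hlast
  set x := Real.exp^[l + 1] u with hx
  have hx0 : 0 < x := pos_of_exp_iterate_one_le (exp_iterate_mono (l + 1) hu1)
  have hdist : ‖Complex.exp^[l + 1] w - (x : ℂ)‖ ≤ x / 2 := by nlinarith
  rw [complexPhase, ← hwdef, Complex.norm_exp, Complex.neg_re, Real.exp_le_exp]
  have := (abs_le.1 ((Complex.abs_re_le_norm _).trans hdist)).1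
  rw [Complex.sub_re, Complex.ofReal_re] at this
  linarith

lemma analyticOnNhd_complexPhase (k : ℕ) (a : ℝ) :
    AnalyticOnNhd ℂ (complexPhase k a) Complex.slitPlane := by
  refine DifferentiableOn.analyticOnNhd (fun z hz => ?_) Complex.isOpen_slitPlane
  have h1 : DifferentiableAt ℂ (fun z => Complex.exp (-(a : ℂ) * Complex.log z)) z :=
    ((Complex.differentiableAt_log hz).const_mul _).cexp
  have h2 : Differentiable ℂ (Complex.exp^[k]) := Complex.differentiable_exp.iterate k
  exact ((h2 _).comp z h1).neg.cexp.differentiableWithinAt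

lemma norm_iteratedDeriv_complexPhase_le {k : ℕ} (hk : 1 ≤ k) {s t : ℝ} (hs : 1 < s) (ht : 0 < t)
    (ht1 : t ≤ 1) (n : ℕ) :
    ‖iteratedDeriv n (complexPhase k (1 / (s - 1))) t‖ ≤
      n.factorial * (discRadius k s)⁻¹ ^ n * (Q k s (Real.exp^[k] (t ^ (-(1 / (s - 1))))) ^ n *
        Real.exp (-(Real.exp^[k] (t ^ (-(1 / (s - 1)))) / 2))) := by
  have hQ : 1 ≤ Q k s (Real.exp^[k] (t ^ (-(1 / (s - 1))))) :=
    one_le_Q (by linarith) (exp_iterate_mono k (rpow_neg_identities hs ht ht1).1)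
  have hδ := discRadius_pos k hs
  have hR : 0 < discRadius k s / Q k s (Real.exp^[k] (t ^ (-(1 / (s - 1))))) := by positivity
  have hdiff : DifferentiableOn ℂ (complexPhase k (1 / (s - 1))) (Metric.closedBall (t : ℂ)
      (discRadius k s / Q k s (Real.exp^[k] (t ^ (-(1 / (s - 1))))))) := by
    refine (analyticOnNhd_complexPhase k _).differentiableOn.mono fun z hz => Or.inl ?_
    rw [mem_closedBall_iff_norm] at hz
    have h1 := (disc_estimates hs ht ht1 hz).1
    have h2 := (abs_lt.1 ((Complex.abs_re_le_norm (z - t)).trans_lt h1)).1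
    rw [Complex.sub_re, Complex.ofReal_re] at h2
    linarith
  refine (Complex.norm_iteratedDeriv_le_of_forall_mem_sphere_norm_le n hR
    (hdiff.diffContOnCl_ball subset_rfl) fun z hz =>
      (disc_estimates hs ht ht1 (mem_sphere_iff_norm.1 hz).le).2 hk).trans (le_of_eq ?_)
  rw [div_pow, inv_pow]
  field_simp

/-- For x ≤ n use monotonicity. For x = yn with y ≥ 1, Q(x) ≤ y^A Q(n), while e^{-x/2} =
(e^{-y/2})^n and y^A e^{-y/2} ≤ 2^A A!. -/
lemma Q_pow_mul_exp_le {k : ℕ} {s x : ℝ} (hs : 0 ≤ s) (hx : Real.exp^[k] 1 ≤ x) {n : ℕ}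
    (hn : Real.exp^[k] 1 ≤ n) :
    Q k s x ^ n * Real.exp (-(x / 2)) ≤
      (2 ^ (⌈s⌉₊ + k) * (⌈s⌉₊ + k).factorial) ^ n * Q k s n ^ n := by
  set A := ⌈s⌉₊ + k
  have hx0 := pos_of_exp_iterate_one_le hx
  have hn0 := pos_of_exp_iterate_one_le hn
  have hQx := one_le_Q hs hx
  have hQn := one_le_Q hs hn
  rcases le_total x n with hxn | hxn
  · have h1 : (1 : ℝ) ≤ (2 ^ A * A.factorial) ^ n := one_le_pow₀
      (one_le_mul_of_one_le_of_one_le (one_le_pow₀ (by norm_num))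
        (by exact_mod_cast A.factorial_pos))
    have h2 : Real.exp (-(x / 2)) ≤ 1 := Real.exp_le_one_iff.2 (by linarith)
    have h3 : Q k s x ^ n ≤ Q k s n ^ n := pow_le_pow_left₀ (by linarith) (Q_le_Q hs hx hxn) n
    calc _ ≤ Q k s n ^ n * 1 := by gcongr
      _ ≤ _ := by rw [mul_comm]; gcongr
  · set y := x / n with hy
    have hy1 : 1 ≤ y := (one_le_div hn0).2 hxn
    have hxy : y * n = x := div_mul_cancel₀ _ hn0.ne'
    have h1 : Q k s x ≤ y ^ A * Q k s n := hxy ▸ Q_mul_le hs hn hy1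
    have h2 : Real.exp (-(x / 2)) = Real.exp (-(y / 2)) ^ n := by
      rw [← Real.exp_nat_mul, ← hxy]; ring_nf
    have h3 : y ^ A * Real.exp (-(y / 2)) ≤ 2 ^ A * A.factorial := by
      have := Real.pow_div_factorial_le_exp (y / 2) (by linarith) A
      rw [div_le_iff₀ (by positivity), div_pow, div_le_iff₀ (by positivity)] at this
      rw [Real.exp_neg, ← div_eq_mul_inv, div_le_iff₀ (Real.exp_pos _)]
      linarith
    rw [h2, ← mul_pow, ← mul_pow]
    refine pow_le_pow_left₀ (by positivity) ?_ n
    calc Q k s x * Real.exp (-(y / 2)) ≤ y ^ A * Q k s n * Real.exp (-(y / 2)) := by gcongr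
      _ = y ^ A * Real.exp (-(y / 2)) * Q k s n := by ring
      _ ≤ _ := by gcongr

/-- The `n`-th derivative of the extremal phase. -/
noncomputable def sharpDeriv (k : ℕ) (s : ℝ) (n : ℕ) (t : ℝ) : ℝ :=
  if 0 < t then (iteratedDeriv n (complexPhase k (1 / (s - 1))) t).re else 0

lemma sharpDeriv_zero (k : ℕ) (s : ℝ) : sharpDeriv k s 0 = sharpPhase k s := by
  funext t
  rw [sharpDeriv, sharpPhase]
  split_ifs with ht
  · have h : Complex.exp (-((1 / (s - 1) : ℝ) : ℂ) * Complex.log t) =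
        ((t ^ (-(1 / (s - 1))) : ℝ) : ℂ) := by
      rw [Real.rpow_def_of_pos ht, ← Complex.ofReal_log ht.le]
      push_cast
      ring_nf
    rw [iteratedDeriv_zero, complexPhase, h, cexp_iterate_ofReal, ← Complex.ofReal_neg,
      ← Complex.ofReal_exp, Complex.ofReal_re]
  · rfl

/-- Quadratic decay is what differentiability at 0 needs. It comes from two spare factors Q(X)t ≥ 1,
paid for by N ≥ n + 2. -/
lemma exists_abs_sharpDeriv_le_sq {k : ℕ} (hk : 1 ≤ k) {s : ℝ} (hs : 1 < s) (n : ℕ) :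
    ∃ C, ∀ t ∈ Set.Ioc (0 : ℝ) 1, |sharpDeriv k s n t| ≤ C * t ^ 2 := by
  obtain ⟨N₀, hN₀⟩ := exists_nat_ge (Real.exp^[k] 1)
  set N := max N₀ (n + 2) with hN
  have hNX : Real.exp^[k] 1 ≤ N := hN₀.trans (by exact_mod_cast le_max_left _ _)
  refine ⟨n.factorial * (discRadius k s)⁻¹ ^ n *
    ((2 ^ (⌈s⌉₊ + k) * (⌈s⌉₊ + k).factorial) ^ N * Q k s N ^ N), fun t ht => ?_⟩
  obtain ⟨hu1, hut⟩ := rpow_neg_identities hs ht.1 ht.2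
  have hX : Real.exp^[k] 1 ≤ Real.exp^[k] (t ^ (-(1 / (s - 1)))) := exp_iterate_mono k hu1
  have hQ1 := one_le_Q (s := s) (by linarith) hX
  have hδ := discRadius_pos k hs
  have hQt : 1 ≤ Q k s (Real.exp^[k] (t ^ (-(1 / (s - 1))))) * t := by
    rw [Q_exp_iterate, mul_right_comm, hut]
    exact one_le_mul_of_one_le_of_one_le hu1 (Finset.prod_induction _ (fun y : ℝ => 1 ≤ y)
      (fun a b ha hb => one_le_mul_of_one_le_of_one_le ha hb) le_rfl
      (fun j _ => one_le_exp_iterate j hu1))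
  have hmain := Q_pow_mul_exp_le (s := s) (by linarith) hX hNX
  rw [sharpDeriv, if_pos ht.1]
  refine (Complex.abs_re_le_norm _).trans
    ((norm_iteratedDeriv_complexPhase_le hk hs ht.1 ht.2 n).trans ?_)
  set q := Q k s (Real.exp^[k] (t ^ (-(1 / (s - 1)))))
  set x := Real.exp^[k] (t ^ (-(1 / (s - 1))))
  have hq : q ^ n ≤ q ^ N * t ^ 2 := by
    calc q ^ n ≤ q ^ n * (q * t) ^ 2 := le_mul_of_one_le_right (by positivity) (one_le_pow₀ hQt)
      _ = q ^ (n + 2) * t ^ 2 := by ring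
      _ ≤ q ^ N * t ^ 2 := by
        gcongr
        exact le_max_right _ _
  rw [mul_assoc _ _ (t ^ 2)]
  refine mul_le_mul_of_nonneg_left ?_ (by positivity)
  calc q ^ n * Real.exp (-(x / 2)) ≤ q ^ N * t ^ 2 * Real.exp (-(x / 2)) := by gcongr
    _ = q ^ N * Real.exp (-(x / 2)) * t ^ 2 := by ring
    _ ≤ _ := by gcongr

lemma hasDerivAt_sharpDeriv {k : ℕ} (hk : 1 ≤ k) {s : ℝ} (hs : 1 < s) (n : ℕ) (t : ℝ) :
    HasDerivAt (sharpDeriv k s n) (sharpDeriv k s (n + 1) t) t := by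
  rcases lt_trichotomy t 0 with ht | rfl | ht
  · have h : sharpDeriv k s n =ᶠ[𝓝 t] fun _ => 0 := by
      filter_upwards [Iio_mem_nhds ht] with x hx
      exact if_neg (not_lt.2 (le_of_lt hx))
    rw [sharpDeriv, if_neg (not_lt.2 ht.le)]
    exact (hasDerivAt_const t (0 : ℝ)).congr_of_eventuallyEq h
  · obtain ⟨C, hC⟩ := exists_abs_sharpDeriv_le_sq hk hs n
    have h0 : ∀ n, sharpDeriv k s n 0 = 0 := fun n => if_neg (lt_irrefl 0)
    rw [h0, hasDerivAt_iff_isLittleO_nhds_zero]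
    have hbig : (fun h : ℝ => sharpDeriv k s n h) =O[𝓝 0] fun h => h ^ 2 := by
      refine IsBigO.of_bound C ?_
      filter_upwards [Iio_mem_nhds (zero_lt_one' ℝ)] with h hh
      rcases lt_or_ge 0 h with hpos | hneg
      · rw [Real.norm_eq_abs, Real.norm_of_nonneg (by positivity)]
        exact hC h ⟨hpos, le_of_lt hh⟩
      · have hC0 : 0 ≤ C := by
          have := (abs_nonneg _).trans (hC 1 ⟨one_pos, le_rfl⟩)
          simpa using this
        rw [sharpDeriv, if_neg (not_lt.2 hneg), norm_zero]
        positivity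
    have hlittle : (fun h : ℝ => h ^ 2) =o[𝓝 0] fun h => h := isLittleO_pow_id one_lt_two
    simpa [h0] using hbig.trans_isLittleO hlittle
  · have hana := (analyticOnNhd_complexPhase k (1 / (s - 1))).iterated_deriv n t (Or.inl (by simpa))
    rw [← iteratedDeriv_eq_iterate] at hana
    have h1 := hana.differentiableAt.hasDerivAt.real_of_complex
    rw [← iteratedDeriv_succ] at h1
    rw [sharpDeriv, if_pos ht]
    refine h1.congr_of_eventuallyEq ?_
    filter_upwards [Ioi_mem_nhds ht] with x hx
    exact if_pos hx

lemma iteratedDeriv_sharpPhase {k : ℕ} (hk : 1 ≤ k) {s : ℝ} (hs : 1 < s) (n : ℕ) :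
    iteratedDeriv n (sharpPhase k s) = sharpDeriv k s n := by
  induction n with
  | zero => rw [iteratedDeriv_zero, sharpDeriv_zero]
  | succ n ih =>
    rw [iteratedDeriv_succ, ih]
    exact funext fun t => (hasDerivAt_sharpDeriv hk hs n t).deriv

lemma contDiff_sharpPhase {k : ℕ} (hk : 1 ≤ k) {s : ℝ} (hs : 1 < s) :
    ContDiff ℝ ∞ (sharpPhase k s) := by
  refine contDiff_of_differentiable_iteratedDeriv fun n _ => ?_
  rw [iteratedDeriv_sharpPhase hk hs]
  exact fun t => (hasDerivAt_sharpDeriv hk hs n t).differentiableAt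

lemma refinedGevrey_sharpPhase {k : ℕ} (hk : 1 ≤ k) {s : ℝ} (hs : 1 < s) :
    RefinedGevrey k s (sharpPhase k s) := by
  have hδ := discRadius_pos k hs
  set K := (discRadius k s)⁻¹ * (2 ^ (⌈s⌉₊ + k) * (⌈s⌉₊ + k).factorial) with hKdef
  have hK : 1 ≤ K := by
    have hs1 : 0 < 1 / (s - 1) := by
      have : 0 < s - 1 := by linarith
      positivity
    refine one_le_mul_of_one_le_of_one_le ?_ (one_le_mul_of_one_le_of_one_le
      (one_le_pow₀ (by norm_num)) (by exact_mod_cast Nat.factorial_pos _))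
    rw [discRadius, inv_inv]
    exact one_le_mul_of_one_le_of_one_le (one_le_pow₀ (by norm_num)) (by linarith)
  refine ⟨(contDiff_sharpPhase hk hs).contDiffOn, K, by linarith, ?_⟩
  filter_upwards [tendsto_natCast_atTop_atTop.eventually (eventually_ge_atTop (Real.exp^[k] 1))]
    with n hn t ht
  have hQn := one_le_Q (s := s) (by linarith) hn
  rw [iteratedDerivWithin_eq_iteratedDeriv (s := I) (uniqueDiffOn_Icc (by norm_num))
    ((contDiff_sharpPhase hk hs).contDiffAt.of_le (by exact_mod_cast le_top)) ht,
    iteratedDeriv_sharpPhase hk hs, sharpDeriv]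
  split_ifs with ht0
  · refine (Complex.abs_re_le_norm _).trans
      ((norm_iteratedDeriv_complexPhase_le hk hs ht0 ht.2 n).trans ?_)
    have h1 := Q_pow_mul_exp_le (s := s) (by linarith)
      (exp_iterate_mono k (rpow_neg_identities hs ht0 ht.2).1) hn
    calc _ ≤ n.factorial * (discRadius k s)⁻¹ ^ n *
          ((2 ^ (⌈s⌉₊ + k) * (⌈s⌉₊ + k).factorial) ^ n * Q k s n ^ n) := by gcongr
      _ = K ^ n * n.factorial * Q k s n ^ n := by rw [hKdef, mul_pow]; ring
      _ ≤ _ := by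
        gcongr
        omega
  · rw [abs_zero]
    positivity

/-! ### Sharpness -/

/-- On average over `λ ∈ [Λ, 2Λ]` the oscillatory integral is small where the phase is large. -/
lemma exists_integral_cos_div_le {ψ : ℝ → ℝ} (hψ : Continuous ψ) {α Λ : ℝ} (hα : 0 < α)
    (hα1 : α ≤ 1) (hΛ : 0 < Λ) (hlow : ∀ t ∈ Set.Icc α 1, 4 ≤ Λ * ψ t) :
    ∃ lam ∈ Set.Ioo Λ (2 * Λ),
      ∫ t in α..(1 : ℝ), Real.cos (lam * ψ t) / t ≤ -Real.log α / 2 := by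
  have h0 : (0 : ℝ) ∉ Set.uIcc α 1 := by
    rw [Set.uIcc_of_le hα1]; exact fun h => absurd h.1 (not_le.2 hα)
  have ht0 : ∀ t ∈ Set.Icc α 1, t ≠ 0 := fun t ht => (hα.trans_le ht.1).ne'
  have hψ0 : ∀ t ∈ Set.Icc α 1, 0 < ψ t := fun t ht => by
    have := hlow t ht
    by_contra hneg
    nlinarith [not_lt.1 hneg]
  have hSc : ∀ x, ContinuousOn (fun t => Real.sin (x * ψ t) / (ψ t * t)) (Set.Icc α 1) := fun x =>
    (by fun_prop : Continuous fun t => Real.sin (x * ψ t)).continuousOn.div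
      (hψ.continuousOn.mul continuousOn_id) fun t ht => mul_ne_zero (hψ0 t ht).ne' (ht0 t ht)
  have hCc : ∀ x, ContinuousOn (fun t => Real.cos (x * ψ t) / t) (Set.Icc α 1) := fun x =>
    (by fun_prop : Continuous fun t => Real.cos (x * ψ t)).continuousOn.div continuousOn_id ht0
  -- A primitive in λ of the cosine integral. It is at most (Λ/4) log(1/α) in size because 1/ψ ≤
  -- Λ/4, so its slope over [Λ, 2Λ], attained at some λ, is at most half of log(1/α).
  have hderiv : ∀ x, HasDerivAt (fun x => ∫ t in α..(1 : ℝ), Real.sin (x * ψ t) / (ψ t * t))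
      (∫ t in α..(1 : ℝ), Real.cos (x * ψ t) / t) x := by
    intro x
    refine (intervalIntegral.hasDerivAt_integral_of_dominated_loc_of_deriv_le
      (F := fun x t => Real.sin (x * ψ t) / (ψ t * t)) (F' := fun x t => Real.cos (x * ψ t) / t)
      (bound := fun t => t⁻¹) (s := Set.univ) univ_mem ?_ ?_ ?_ ?_ ?_ ?_).2
    · refine Eventually.of_forall fun y => ?_
      rw [Set.uIoc_of_le hα1]
      exact ((hSc y).mono Set.Ioc_subset_Icc_self).aestronglyMeasurable measurableSet_Ioc
    · exact (hSc x).intervalIntegrable_of_Icc hα1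
    · rw [Set.uIoc_of_le hα1]
      exact ((hCc x).mono Set.Ioc_subset_Icc_self).aestronglyMeasurable measurableSet_Ioc
    · refine Eventually.of_forall fun t ht y _ => ?_
      rw [Set.uIoc_of_le hα1] at ht
      have htp : 0 < t := hα.trans ht.1
      rw [norm_div, Real.norm_of_nonneg htp.le, div_eq_mul_inv]
      exact mul_le_of_le_one_left (inv_nonneg.2 htp.le) (Real.abs_cos_le_one _)
    · exact intervalIntegrable_inv_iff.2 (Or.inr h0)
    · refine Eventually.of_forall fun t ht y _ => ?_
      rw [Set.uIoc_of_le hα1] at ht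
      have h1 := hψ0 t ⟨ht.1.le, ht.2⟩
      have h2 := ht0 t ⟨ht.1.le, ht.2⟩
      refine (((hasDerivAt_mul_const (ψ t)).sin).div_const (ψ t * t)).congr_deriv ?_
      field_simp
  have hbound : ∀ x, |∫ t in α..(1 : ℝ), Real.sin (x * ψ t) / (ψ t * t)| ≤
      Λ / 4 * -Real.log α := by
    intro x
    rw [← Real.norm_eq_abs]
    refine (intervalIntegral.norm_integral_le_of_norm_le (g := fun t => Λ / 4 * t⁻¹) hα1
      (Eventually.of_forall fun t ht => ?_) ?_).trans (le_of_eq ?_)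
    · have ht' : t ∈ Set.Icc α 1 := ⟨ht.1.le, ht.2⟩
      have htp : 0 < t := hα.trans ht.1
      have h1 := hψ0 t ht'
      rw [norm_div, norm_mul, Real.norm_of_nonneg htp.le, Real.norm_of_nonneg h1.le,
        ← div_div, div_eq_mul_inv _ t]
      refine mul_le_mul_of_nonneg_right ?_ (inv_nonneg.2 htp.le)
      rw [div_le_iff₀ h1]
      have := Real.abs_sin_le_one (x * ψ t)
      have h2 := hlow t ht'
      rw [Real.norm_eq_abs]
      linarith
    · exact (intervalIntegrable_inv_iff.2 (Or.inr h0)).const_mul _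
    · rw [intervalIntegral.integral_const_mul, integral_inv_of_pos hα one_pos, one_div,
        Real.log_inv]
  obtain ⟨lam, hlam, heq⟩ := exists_hasDerivAt_eq_slope
    (fun x => ∫ t in α..(1 : ℝ), Real.sin (x * ψ t) / (ψ t * t))
    (fun x => ∫ t in α..(1 : ℝ), Real.cos (x * ψ t) / t) (by linarith : Λ < 2 * Λ)
    (fun x _ => (hderiv x).continuousAt.continuousWithinAt) (fun x _ => hderiv x)
  refine ⟨lam, hlam, ?_⟩
  rw [heq, div_le_iff₀ (by linarith)]
  have h1 := (abs_le.1 (hbound (2 * Λ))).2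
  have h2 := (abs_le.1 (hbound Λ)).1
  linarith

lemma sharpPhase_of_nonpos {k : ℕ} {s t : ℝ} (ht : t ≤ 0) : sharpPhase k s t = 0 :=
  if_neg (not_lt.2 ht)

lemma m_sharpPhase {k : ℕ} (hk : 1 ≤ k) {s : ℝ} (hs : 1 < s) (lam : ℝ) :
    m (sharpPhase k s) lam = oneSided (sharpPhase k s) lam := by
  rw [(m_eq (contDiff_sharpPhase hk hs).contDiffOn lam).2, sub_eq_self, oneSided]
  refine (intervalIntegral.integral_congr (g := fun _ => 0) fun t ht => ?_).trans
    intervalIntegral.integral_zero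
  rw [Set.uIcc_of_le zero_le_one] at ht
  simp [sharpPhase_of_nonpos (k := k) (s := s) (by linarith [ht.1] : -t ≤ 0),
    sharpPhase_of_nonpos (k := k) (s := s) le_rfl]

/-- -Re m is the integral of (1 - cos λψ)/t ≥ 0, so the part on [0, α] may be dropped. -/
lemma le_norm_m_sharpPhase {k : ℕ} (hk : 1 ≤ k) {s : ℝ} (hs : 1 < s) (lam : ℝ) {α : ℝ}
    (hα : 0 < α) (hα1 : α ≤ 1) :
    -Real.log α - ∫ t in α..(1 : ℝ), Real.cos (lam * sharpPhase k s t) / t ≤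
      ‖m (sharpPhase k s) lam‖ := by
  set ψ := sharpPhase k s with hψ
  have hcont : Continuous ψ := (contDiff_sharpPhase hk hs).continuous
  have hchain := isDerivChain_right (contDiff_sharpPhase hk hs).contDiffOn
  have hψ0 : ψ 0 = 0 := sharpPhase_of_nonpos le_rfl
  have hint := hchain.intervalIntegrable_oneSided lam
  have hsplit := hchain.oneSided_eq_add lam hα hα1
  simp only [iteratedDerivWithin_zero, ← hψ] at hint hsplit
  have hre : ∀ t : ℝ, ((Complex.exp (Complex.I * lam * ψ t) -
      Complex.exp (Complex.I * lam * ψ 0)) / (t : ℂ)).re = Real.cos (lam * ψ t) / t - 1 / t := by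
    intro t
    rw [Complex.div_ofReal_re, hψ0, Complex.ofReal_zero, mul_zero, Complex.exp_zero,
      Complex.sub_re, Complex.one_re, sub_div,
      show Complex.I * (lam : ℂ) * ψ t = ((lam * ψ t : ℝ) : ℂ) * Complex.I by push_cast; ring,
      Complex.exp_ofReal_mul_I_re]
  have hint1 := hint.mono_set (c := 0) (d := α) (by
    rw [Set.uIcc_of_le hα.le, Set.uIcc_of_le zero_le_one]; exact Set.Icc_subset_Icc_right hα1)
  have hint2 := hint.mono_set (c := α) (d := 1) (by
    rw [Set.uIcc_of_le hα1, Set.uIcc_of_le zero_le_one]; exact Set.Icc_subset_Icc_left hα.le)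
  have h1 := intervalIntegral.intervalIntegral_re hint1
  have h2 := intervalIntegral.intervalIntegral_re hint2
  simp only [RCLike.re_eq_complex_re, hre] at h1 h2
  have hneg : ∫ t in (0 : ℝ)..α, (Real.cos (lam * ψ t) / t - 1 / t) ≤ 0 := by
    rw [← neg_nonneg, ← intervalIntegral.integral_neg]
    refine intervalIntegral.integral_nonneg hα.le fun t ht => ?_
    rw [← sub_div, ← neg_div, neg_sub]
    exact div_nonneg (by linarith [Real.cos_le_one (lam * ψ t)]) ht.1
  have h0 : (0 : ℝ) ∉ Set.uIcc α 1 := by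
    rw [Set.uIcc_of_le hα1]; exact fun h => absurd h.1 (not_le.2 hα)
  have hcosint : IntervalIntegrable (fun t => Real.cos (lam * ψ t) / t)
      MeasureTheory.volume α 1 := by
    refine ContinuousOn.intervalIntegrable_of_Icc hα1 ?_
    exact (by fun_prop : Continuous fun t => Real.cos (lam * ψ t)).continuousOn.div continuousOn_id
      fun t ht => (hα.trans_le ht.1).ne'
  have hone : IntervalIntegrable (fun t : ℝ => 1 / t) MeasureTheory.volume α 1 := by
    simpa only [one_div] using intervalIntegrable_inv_iff.2 (Or.inr h0)
  rw [intervalIntegral.integral_sub hcosint hone, integral_one_div_of_pos hα one_pos, one_div,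
    Real.log_inv] at h2
  have habs := (abs_le.1 (Complex.abs_re_le_norm (m ψ lam))).1
  rw [m_sharpPhase hk hs, ← hψ, hsplit, Complex.add_re, ← h1, ← h2] at habs
  rw [m_sharpPhase hk hs, ← hψ, hsplit]
  linarith

/-- For α = y^{-(s-1)} the phase is at least 1/E on [α, 1], E = E_{k+1}(y), so Λ = 4E is admissible.
Then |m(λ)| ≥ (s - 1)(log y)/2, while λ < 8E gives log^{(k+2)} λ ≤ 8 log y; hence 16/(s - 1). -/
lemma exists_large_norm_m_sharpPhase {k : ℕ} (hk : 1 ≤ k) {s : ℝ} (hs : 1 < s) {y : ℝ}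
    (hy : Real.exp 1 ≤ y) :
    ∃ lam, y ≤ lam ∧ 0 ≤ Real.log^[k + 2] lam ∧
      Real.log^[k + 2] lam ≤ 16 / (s - 1) * ‖m (sharpPhase k s) lam‖ := by
  have hs1 : 0 < s - 1 := by linarith
  have hy0 : 0 < y := (Real.exp_pos 1).trans_le hy
  have hlogy : 1 ≤ Real.log y := (Real.le_log_iff_exp_le hy0).2 hy
  have hy1 : 1 ≤ y := by linarith [Real.add_one_le_exp (1 : ℝ)]
  set α := y ^ (-(s - 1)) with hαdef
  have hα : 0 < α := Real.rpow_pos_of_pos hy0 _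
  have hα1 : α ≤ 1 := Real.rpow_le_one_of_one_le_of_nonpos hy1 (by linarith)
  have hlogα : Real.log α = -((s - 1) * Real.log y) := by
    rw [hαdef, Real.log_rpow hy0]; ring
  set E := Real.exp^[k + 1] y with hE
  have hyE : y ≤ E := exp_iterate_le_exp_iterate (Nat.zero_le (k + 1)) y
  have hE0 : 0 < E := hy0.trans_le hyE
  have hlow : ∀ t ∈ Set.Icc α 1, 4 ≤ 4 * E * sharpPhase k s t := by
    intro t ht
    have ht0 : 0 < t := hα.trans_le ht.1
    have hta : t ^ (-(1 / (s - 1))) ≤ y := by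
      calc t ^ (-(1 / (s - 1))) ≤ α ^ (-(1 / (s - 1))) :=
            Real.rpow_le_rpow_of_nonpos hα ht.1 (by
              have : 0 < 1 / (s - 1) := by positivity
              linarith)
        _ = y := by
            rw [hαdef, ← Real.rpow_mul hy0.le, neg_mul_neg, mul_one_div_cancel hs1.ne',
              Real.rpow_one]
    rw [sharpPhase, if_pos ht0, hE, Function.iterate_succ_apply', mul_assoc, ← Real.exp_add]
    have := Real.one_le_exp (sub_nonneg.2 (exp_iterate_mono k hta))
    rw [← sub_eq_add_neg]
    linarith
  obtain ⟨lam, hlam, hcos⟩ := exists_integral_cos_div_le (contDiff_sharpPhase hk hs).continuous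
    hα hα1 (by positivity : 0 < 4 * E) hlow
  have hX : Real.exp^[k + 2] 1 ≤ E := exp_iterate_mono (k + 1) hy
  have hElam : E ≤ lam := by linarith [hlam.1]
  refine ⟨lam, hyE.trans hElam, ?_, ?_⟩
  · linarith [one_le_log_iterate (hX.trans hElam)]
  · have h1 := le_norm_m_sharpPhase hk hs lam hα hα1
    have h2 : Real.log^[k + 2] lam ≤ 8 * Real.log y := by
      calc Real.log^[k + 2] lam ≤ Real.log^[k + 2] (8 * E) :=
            log_iterate_le_log_iterate (hX.trans hElam) (by linarith [hlam.2])
        _ ≤ 8 * Real.log^[k + 2] E := log_iterate_mul_le hX (by norm_num)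
        _ = 8 * Real.log y := by
            rw [Function.iterate_succ_apply', hE, log_iterate_exp_iterate le_rfl, Nat.sub_self,
              Function.iterate_zero_apply]
    refine h2.trans ?_
    rw [hlogα] at h1 hcos
    rw [div_mul_eq_mul_div, le_div_iff₀ hs1]
    linarith

end SteinWainger

theorem theorem1p4 (k : ℕ) (hk : 1 ≤ k) (s : ℝ) (hs : 1 < s) :
    (∀ ψ : ℝ → ℝ, SteinWainger.RefinedGevrey k s ψ →
      (∀ lam : ℝ, Tendsto (SteinWainger.truncated ψ lam) (𝓝[>] 0)
        (𝓝 (SteinWainger.m ψ lam))) ∧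
      SteinWainger.m ψ =O[atTop] (fun lam : ℝ => Real.log^[k + 2] lam)) ∧
    SteinWainger.RefinedGevrey k s (SteinWainger.sharpPhase k s) ∧
    ∃ lam : ℕ → ℝ, Tendsto lam atTop atTop ∧
      (fun n => ‖SteinWainger.m (SteinWainger.sharpPhase k s) (lam n)‖)
        =Θ[atTop] (fun n => Real.log^[k + 2] (lam n)) := by
  have hG := SteinWainger.refinedGevrey_sharpPhase hk hs
  refine ⟨fun ψ hψ => ⟨fun lam => (SteinWainger.m_eq hψ.1 lam).1, SteinWainger.m_isBigO hk hs hψ⟩,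
    hG, ?_⟩
  have hex := fun n : ℕ => SteinWainger.exists_large_norm_m_sharpPhase hk hs
    (le_add_of_nonneg_left (Nat.cast_nonneg n) : Real.exp 1 ≤ n + Real.exp 1)
  choose lam hlam hnonneg hle using hex
  have hlim : Tendsto lam atTop atTop := tendsto_atTop_mono
    (fun n => (le_add_of_nonneg_right (Real.exp_pos 1).le).trans (hlam n))
    tendsto_natCast_atTop_atTop
  refine ⟨lam, hlim, ((SteinWainger.m_isBigO hk hs hG).comp_tendsto hlim).norm_left, ?_⟩
  refine IsBigO.of_bound (16 / (s - 1)) (Eventually.of_forall fun n => ?_)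
  rw [Real.norm_of_nonneg (hnonneg n), norm_norm]
  exact hle n
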